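/- Consider two bosonic modes with annihilation operators $\hat a,\hat b$ and Fock states $|m,n\rangle$. Let $g\in\mathbb R$, $\alpha,\beta\in\mathbb C$, $\eta\in[0,1]$, and put $T_g=\tanh g$, $R=1-\eta$. Let $$|\psi\rangle=\hat D_a(\alpha)\,\hat D_b(\beta)\,\hat S_2(g)\,|0,0\rangle,\qquad \hat D_a(\alpha)=e^{\alpha\hat a^\dagger-\alpha^*\hat a},\quad \hat D_b(\beta)=e^{\beta\hat b^\dagger-\beta^*\hat b},\quad \hat S_2(g)=e^{g(\hat a^\dagger\hat b^\dagger-\hat a\hat b)},$$ so that $\hat S_2(g)|0,0\rangle=\sqrt{1-T_g^2}\,e^{T_g\hat a^\dagger\hat b^\dagger}|0,0\rangle$ is the two-mode squeezed vacuum. The modes are measured with non-photon-number-resolving detectors of efficiency $\eta$, whose no-click operators are $R^{\hat a^\dagger\hat a}$ and $R^{\hat b^\dagger\hat b}$ (with $0^0=1$). Then the joint no-click probability $\mathcal P(00|\alpha,\beta)=\langle\psi|R^{\hat a^\dagger\hat a+\hat b^\dagger\hat b}|\psi\rangle$ and the marginal no-click probabilities $\mathcal P(0|\alpha)=\langle\psi|R^{\hat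 a^\dagger\hat a}|\psi\rangle$ and $\mathcal P(0|\beta)=\langle\psi|R^{\hat b^\dagger\hat b}|\psi\rangle$ are $$\mathcal P(00|\alpha,\beta)=\frac{1-T_g^2}{1-R^2T_g^2}\exp\!\Big((|\alpha|^2+|\beta|^2)\frac{1-R+R^2T_g^2-RT_g^2}{R^2T_g^2-1}-\frac{2\,\mathrm{Re}(\alpha\beta)\,T_g(R-1)^2}{R^2T_g^2-1}\Big),$$ $$\mathcal P(0|\alpha)=\frac{1-T_g^2}{1-RT_g^2}\exp\!\Big(|\alpha|^2\,\frac{1-R+RT_g^2-T_g^2}{RT_g^2-1}\Big),\qquad \mathcal P(0|\beta)=\frac{1-T_g^2}{1-RT_g^2}\exp\!\Big(|\beta|^2\,\frac{1-R+RT_g^2-T_g^2}{RT_g^2-1}\Big).$$ -/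

import Mathlib

open scoped InnerProductSpace

/-- The Hilbert space of two bosonic modes in the photon-number basis: `ℓ²(ℕ × ℕ)`, with the
coordinate at `(m, n)` being the amplitude of the Fock state `|m, n⟩`. -/
abbrev TwoModeFock : Type := lp (fun _ : ℕ × ℕ => ℂ) 2

/-- The finite linear combinations of Fock states `|m, n⟩`. -/
abbrev FiniteFock : Type := (ℕ × ℕ) →₀ ℂ

/-- The Fock state `|m, n⟩`, where `k = (m, n)`. -/
noncomputable def fockState (k : ℕ × ℕ) : TwoModeFock := lp.single 2 k (1 : ℂ)

/-- The inclusion of the finite linear combinations of Fock states into the Hilbert space. -/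
noncomputable def toFock : FiniteFock →ₗ[ℂ] TwoModeFock :=
  Finsupp.linearCombination ℂ fockState

/-- Annihilation in the first mode: `a |m, n⟩ = √m |m - 1, n⟩` (zero for `m = 0`). -/
noncomputable def annA : Module.End ℂ FiniteFock :=
  Finsupp.linearCombination ℂ fun k => Finsupp.single (k.1 - 1, k.2) (Real.sqrt k.1 : ℂ)

/-- Creation in the first mode: `a† |m, n⟩ = √(m + 1) |m + 1, n⟩`. -/
noncomputable def creA : Module.End ℂ FiniteFock :=
  Finsupp.linearCombination ℂ fun k => Finsupp.single (k.1 + 1, k.2) (Real.sqrt (k.1 + 1) : ℂ)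

/-- Annihilation in the second mode: `b |m, n⟩ = √n |m, n - 1⟩` (zero for `n = 0`). -/
noncomputable def annB : Module.End ℂ FiniteFock :=
  Finsupp.linearCombination ℂ fun k => Finsupp.single (k.1, k.2 - 1) (Real.sqrt k.2 : ℂ)

/-- Creation in the second mode: `b† |m, n⟩ = √(n + 1) |m, n + 1⟩`. -/
noncomputable def creB : Module.End ℂ FiniteFock :=
  Finsupp.linearCombination ℂ fun k => Finsupp.single (k.1, k.2 + 1) (Real.sqrt (k.2 + 1) : ℂ)

/-- The graph, in the product of the Hilbert space with itself, of the closure of the operator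
`A` given on the finite linear combinations of Fock states. -/
noncomputable def closedGraph (A : Module.End ℂ FiniteFock) :
    Submodule ℂ (TwoModeFock × TwoModeFock) :=
  (LinearMap.range (toFock.prod (toFock ∘ₗ A))).topologicalClosure

/-- `u` is a mild solution of `u' = Ā u`, `u 0 = φ`, where `Ā` is the closure of `A`: it is
continuous, and for every `t` the vector `∫₀ᵗ u` is in the domain of `Ā` with
`Ā (∫₀ᵗ u) = u t - φ`. If `Ā` generates a strongly continuous group, then the one mild solution
is `u t = exp (t Ā) φ`, for every vector `φ`. -/
def IsMildSolution (A : Module.End ℂ FiniteFock) (φ : TwoModeFock) (u : ℝ → TwoModeFock) : Prop :=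
  Continuous u ∧ ∀ t : ℝ, ((∫ s in (0 : ℝ)..t, u s), u t - φ) ∈ closedGraph A

/-- For a skew-symmetric operator mild solutions are unique. -/
theorem IsMildSolution.unique {A : Module.End ℂ FiniteFock}
    (hA : ∀ v : FiniteFock, (⟪toFock v, toFock (A v)⟫_ℂ).re = 0)
    {φ : TwoModeFock} {u w : ℝ → TwoModeFock}
    (hu : IsMildSolution A φ u) (hw : IsMildSolution A φ w) : u = w := by
  have key : ∀ p ∈ closedGraph A, (⟪p.1, p.2⟫_ℂ).re = 0 := by
    have hc : IsClosed {p : TwoModeFock × TwoModeFock | (⟪p.1, p.2⟫_ℂ).re = 0} :=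
      isClosed_eq (Complex.continuous_re.comp (continuous_fst.inner continuous_snd))
        continuous_const
    intro p hp
    have hp' : p ∈ closure
        ((LinearMap.range (toFock.prod (toFock ∘ₗ A)) :
          Submodule ℂ (TwoModeFock × TwoModeFock)) : Set (TwoModeFock × TwoModeFock)) := hp
    refine closure_minimal ?_ hc hp'
    rintro _ ⟨v, rfl⟩
    exact hA v
  have hd : Continuous fun t => u t - w t := hu.1.sub hw.1
  set F : ℝ → TwoModeFock := fun t => ∫ s in (0 : ℝ)..t, (u s - w s) with hF
  have hFd : ∀ t, HasDerivAt F (u t - w t) t := fun t =>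
    intervalIntegral.integral_hasDerivAt_right (hd.intervalIntegrable _ _)
      hd.stronglyMeasurable.stronglyMeasurableAtFilter hd.continuousAt
  have hmem : ∀ t, (F t, u t - w t) ∈ closedGraph A := by
    intro t
    have h := (closedGraph A).sub_mem (hu.2 t) (hw.2 t)
    have e : F t = (∫ s in (0 : ℝ)..t, u s) - ∫ s in (0 : ℝ)..t, w s :=
      intervalIntegral.integral_sub (hu.1.intervalIntegrable _ _) (hw.1.intervalIntegrable _ _)
    rw [e]
    simpa using h
  have hn : ∀ t, HasDerivAt (fun t => ‖F t‖ ^ 2) 0 t := by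
    intro t
    have h := (hFd t).inner ℂ (hFd t)
    have h2 := (Complex.reCLM.hasFDerivAt.comp_hasDerivAt t h)
    have k1 := key _ (hmem t)
    have k2 : (⟪u t - w t, F t⟫_ℂ).re = 0 := by
      rw [← inner_conj_symm, Complex.conj_re]; exact k1
    have e1 : (fun t => ‖F t‖ ^ 2) = Complex.reCLM ∘ fun t => ⟪F t, F t⟫_ℂ := by
      funext s
      simp [inner_self_eq_norm_sq_to_K, ← Complex.ofReal_pow]
    have e2 : Complex.reCLM (⟪F t, u t - w t⟫_ℂ + ⟪u t - w t, F t⟫_ℂ) = 0 := by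
      simp only [Complex.reCLM_apply, Complex.add_re]
      rw [k2, add_zero]; exact k1
    rw [e1, ← e2]
    exact h2
  have hz : ∀ t, F t = 0 := by
    intro t
    have h := is_const_of_deriv_eq_zero (fun t => (hn t).differentiableAt)
      (fun t => (hn t).deriv) t 0
    have h0 : F 0 = 0 := by simp [hF]
    simpa [h0] using h
  funext t
  have h1 : HasDerivAt F 0 t := by
    have : F = fun _ => 0 := funext hz
    rw [this]; exact hasDerivAt_const _ _
  exact sub_eq_zero.mp ((hFd t).unique h1)

open Classical in
/-- The operator `exp A` on the Hilbert space, for an operator `A` given on the finite linear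
combinations of Fock states and essentially skew-adjoint there (as are the two generators below):
`exp A φ` is the value at time `1` of the mild solution of `u' = Ā u`, `u 0 = φ`. -/
noncomputable def expOp (A : Module.End ℂ FiniteFock) (φ : TwoModeFock) : TwoModeFock :=
  if h : ∃ u, IsMildSolution A φ u then h.choose 1 else 0

/-- The displacement `exp (α a† - α* a)` of the first mode. -/
noncomputable def displaceA (α : ℂ) : TwoModeFock → TwoModeFock :=
  expOp (α • creA - (starRingEnd ℂ) α • annA)

/-- The displacement `exp (β b† - β* b)` of the second mode. -/
noncomputable def displaceB (β : ℂ) : TwoModeFock → TwoModeFock :=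
  expOp (β • creB - (starRingEnd ℂ) β • annB)

/-- The two-mode squeezer `exp (g (a† b† - a b))`. -/
noncomputable def twoModeSqueezer (g : ℝ) : TwoModeFock → TwoModeFock :=
  expOp ((g : ℂ) • (creA * creB - annA * annB))

/-- The state `D_a(α) D_b(β) S₂(g) |0, 0⟩` of the circuit. -/
noncomputable def circuitState (g : ℝ) (α β : ℂ) : TwoModeFock :=
  displaceA α (displaceB β (twoModeSqueezer g (fockState (0, 0))))

/-- The operator that is diagonal in the photon-number basis with eigenvalues `w (m, n)`. -/
noncomputable def diagonalOp (w : ℕ × ℕ → unitInterval) : TwoModeFock →L[ℂ] TwoModeFock :=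
  have bound : ∀ (φ : TwoModeFock) (k : ℕ × ℕ), ‖((w k : ℝ) : ℂ) * φ k‖ ≤ ‖φ k‖ := fun φ k => by
    rw [norm_mul, Complex.norm_real, Real.norm_of_nonneg (w k).2.1]
    exact mul_le_of_le_one_left (norm_nonneg _) (w k).2.2
  LinearMap.mkContinuous
    { toFun := fun φ => ⟨fun k => ((w k : ℝ) : ℂ) * φ k, (lp.memℓp φ).mono' (bound φ)⟩
      map_add' := fun φ ψ => by ext k; exact mul_add _ _ _
      map_smul' := fun c φ => by ext k; exact mul_left_comm _ _ _ }
    1 fun φ => by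
      rw [one_mul]
      exact lp.norm_mono (by norm_num) (bound φ)

/-- The joint no-click operator `R ^ (a† a + b† b)`, `R = 1 - η`, of two detectors of
efficiency `η`. -/
noncomputable def noClickAB (η : unitInterval) : TwoModeFock →L[ℂ] TwoModeFock :=
  diagonalOp fun k => unitInterval.symm η ^ (k.1 + k.2)

/-- The no-click operator `R ^ (a† a)`, `R = 1 - η`, of the detector of the first mode. -/
noncomputable def noClickA (η : unitInterval) : TwoModeFock →L[ℂ] TwoModeFock :=
  diagonalOp fun k => unitInterval.symm η ^ k.1

/-- The no-click operator `R ^ (b† b)`, `R = 1 - η`, of the detector of the second mode. -/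
noncomputable def noClickB (η : unitInterval) : TwoModeFock →L[ℂ] TwoModeFock :=
  diagonalOp fun k => unitInterval.symm η ^ k.2

/-!
The squeezer applied to the vacuum, the displacements and the damping operators `xᵐ yⁿ` all stay
within the multiples of the Gaussian exponential vectors
`E(T, l, u) = exp (T a† b† + l a† + u b†) |0, 0⟩`, `‖T‖ < 1`, so every step is explicit.

The amplitudes of `E(T, l, u)` satisfy the two recursions expressing `a = T b† + l` and
`b = T a† + u`; these give their derivatives in the parameters (`hasDerivAt_expCoeff`) and a
geometric bound, locally uniform in the parameters (`exists_norm_expCoeff_le_geometric`). By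
dominated convergence, the images of `E(T, l, u)` under the ladder operators depend continuously on
the parameters, and `E(T, l, u)` is in the domain of the closure of each generator
(`expVec_mem_closedGraph`). A curve `c(t) E(T(t), l(t), u(t))` whose formal derivative is the
generator applied to it is then a mild solution, and its norm is constant because the generator is
skew-symmetric (`expOp_eq_of_expVec_curve`). Solving the resulting ordinary differential equations
for the squeezer and the two displacements yields
`D_a(α) D_b(β) S₂(g) |0, 0⟩ = c E(T, α - β* T, β - α* T)` with `T = tanh g` and
`|c|² = (1 - T²) exp (-(|α|² + |β|²) + 2 T Re (α β))` (`circuitState_eq`).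

No Gaussian sum has to be evaluated: as this state has norm one and every `E(T, l, u)` with real
`T ∈ (-1, 1)` is a multiple of such a state, unitarity alone gives `‖E(T, l, u)‖²` in closed form
(`norm_sq_expVec`). Finally, multiplying the amplitudes of `E(T, l, u)` by `√xᵐ √yⁿ` gives
`E(√x √y T, √x l, √y u)`, so the expectation of the operator with eigenvalues `xᵐ yⁿ` is again such
a norm (`inner_circuitState_diagonalOp`). The three no-click probabilities are the cases
`(x, y) = (R, R), (R, 1), (1, R)`.
-/

/-! ### Amplitudes of the Gaussian exponential vectors -/

/-- The amplitude at the Fock state `|m, n⟩` of `exp (T a† b† + l a† + u b†) |0, 0⟩`, that is,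
`√(m! n!)` times the coefficient of `z ^ m * w ^ n` in `exp (T z w + l z + u w)`. It is defined by
the recursion that expresses `a = T b† + l` on this vector; for `n = 0` the truncated `n - 1`
carries the factor `√0 = 0`. -/
noncomputable def expCoeff (T l u : ℂ) : ℕ → ℕ → ℂ
  | 0, n => u ^ n / (Real.sqrt n.factorial : ℂ)
  | m + 1, n => (T * (Real.sqrt n : ℂ) * expCoeff T l u m (n - 1) + l * expCoeff T l u m n) /
      (Real.sqrt (m + 1) : ℂ)

lemma ofReal_sqrt_sq {x : ℝ} (hx : 0 ≤ x) : (Real.sqrt x : ℂ) * (Real.sqrt x : ℂ) = x := by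
  rw [← Complex.ofReal_mul, Real.mul_self_sqrt hx]

lemma ofReal_sqrt_succ_ne_zero (n : ℕ) : (Real.sqrt (n + 1) : ℂ) ≠ 0 := by
  have : 0 < Real.sqrt (n + 1) := Real.sqrt_pos.mpr (by positivity)
  exact_mod_cast this.ne'

lemma ofReal_sqrt_succ_sq (n : ℕ) :
    (Real.sqrt (n + 1) : ℂ) * (Real.sqrt (n + 1) : ℂ) = n + 1 := by
  rw [ofReal_sqrt_sq (by positivity)]; simp

lemma ofReal_sqrt_factorial_succ (n : ℕ) :
    (Real.sqrt (n + 1).factorial : ℂ) = Real.sqrt (n + 1) * Real.sqrt n.factorial := by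
  rw [Nat.factorial_succ, Nat.cast_mul, Real.sqrt_mul (Nat.cast_nonneg _)]
  push_cast; rfl

lemma ofReal_sqrt_factorial_ne_zero (n : ℕ) : (Real.sqrt n.factorial : ℂ) ≠ 0 := by
  have : 0 < Real.sqrt n.factorial := Real.sqrt_pos.mpr (by exact_mod_cast n.factorial_pos)
  exact_mod_cast this.ne'

section recursion

variable (T l u : ℂ)

lemma sqrt_mul_expCoeff_succ_left (m n : ℕ) :
    (Real.sqrt (m + 1) : ℂ) * expCoeff T l u (m + 1) n =
      T * (Real.sqrt n : ℂ) * expCoeff T l u m (n - 1) + l * expCoeff T l u m n := by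
  rw [expCoeff]
  exact mul_div_cancel₀ _ (ofReal_sqrt_succ_ne_zero m)

lemma nat_mul_expCoeff_left (m n : ℕ) :
    (m : ℂ) * expCoeff T l u m n =
      T * (Real.sqrt m : ℂ) * (Real.sqrt n : ℂ) * expCoeff T l u (m - 1) (n - 1) +
        l * (Real.sqrt m : ℂ) * expCoeff T l u (m - 1) n := by
  rcases m with _ | m
  · simp
  · have h := sqrt_mul_expCoeff_succ_left T l u m n
    have hs := ofReal_sqrt_succ_sq m
    simp only [Nat.add_sub_cancel]
    push_cast
    linear_combination (Real.sqrt (m + 1) : ℂ) * h - expCoeff T l u (m + 1) n * hs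

/-- The relation `b = T a† + u` on the exponential vector, symmetric to the defining recursion. -/
lemma sqrt_mul_expCoeff_succ_right (m n : ℕ) :
    (Real.sqrt (n + 1) : ℂ) * expCoeff T l u m (n + 1) =
      T * (Real.sqrt m : ℂ) * expCoeff T l u (m - 1) n + u * expCoeff T l u m n := by
  induction m generalizing n with
  | zero =>
    have h1 := ofReal_sqrt_succ_ne_zero n
    have h2 := ofReal_sqrt_factorial_ne_zero n
    simp only [expCoeff, ofReal_sqrt_factorial_succ]
    simp only [Nat.cast_zero, Real.sqrt_zero, Complex.ofReal_zero]
    field_simp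
    ring
  | succ m ih =>
    have hm := ofReal_sqrt_succ_ne_zero m
    have e1 := sqrt_mul_expCoeff_succ_left T l u m (n + 1)
    have e2 := sqrt_mul_expCoeff_succ_left T l u m n
    have e3 := nat_mul_expCoeff_left T l u m n
    have e4 : (n : ℂ) * expCoeff T l u m n =
        T * (Real.sqrt m : ℂ) * (Real.sqrt n : ℂ) * expCoeff T l u (m - 1) (n - 1) +
        u * (Real.sqrt n : ℂ) * expCoeff T l u m (n - 1) := by
      rcases n with _ | n
      · simp
      · have h := ih n
        have hs := ofReal_sqrt_succ_sq n
        simp only [Nat.add_sub_cancel]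
        push_cast
        linear_combination (Real.sqrt (n + 1) : ℂ) * h - expCoeff T l u m (n + 1) * hs
    have e5 := ih n
    have sm := ofReal_sqrt_succ_sq m
    have sn := ofReal_sqrt_succ_sq n
    simp only [Nat.add_sub_cancel] at e1 ⊢
    push_cast at e1 ⊢
    apply mul_left_cancel₀ hm
    linear_combination (Real.sqrt (n + 1) : ℂ) * e1 - u * e2 + l * e5 +
      T * expCoeff T l u m n * sn - T * expCoeff T l u m n * sm + T * e4 - T * e3

lemma nat_mul_expCoeff_right (m n : ℕ) :
    (n : ℂ) * expCoeff T l u m n =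
      T * (Real.sqrt m : ℂ) * (Real.sqrt n : ℂ) * expCoeff T l u (m - 1) (n - 1) +
        u * (Real.sqrt n : ℂ) * expCoeff T l u m (n - 1) := by
  rcases n with _ | n
  · simp
  · have h := sqrt_mul_expCoeff_succ_right T l u m n
    have hs := ofReal_sqrt_succ_sq n
    simp only [Nat.add_sub_cancel]
    push_cast
    linear_combination (Real.sqrt (n + 1) : ℂ) * h - expCoeff T l u m (n + 1) * hs

/-- Damping the two modes by `x` and `y` rescales the parameters of the exponential vector. -/
lemma expCoeff_scale (x y : ℂ) (m n : ℕ) :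
    x ^ m * y ^ n * expCoeff T l u m n = expCoeff (x * y * T) (x * l) (y * u) m n := by
  induction m generalizing n with
  | zero => simp only [expCoeff, mul_pow]; ring
  | succ m ih =>
    simp only [expCoeff, ← ih]
    rcases n with _ | n
    · simp only [Nat.cast_zero, Real.sqrt_zero, Complex.ofReal_zero]; ring
    · simp only [Nat.add_sub_cancel]; ring

end recursion

/-- The chain rule for the amplitudes: the derivatives in the three parameters are the actions of
`a† b†`, `a†` and `b†`. -/
lemma hasDerivAt_expCoeff {T l u : ℝ → ℂ} {T' l' u' : ℂ} {t : ℝ} (hT : HasDerivAt T T' t)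
    (hl : HasDerivAt l l' t) (hu : HasDerivAt u u' t) (m n : ℕ) :
    HasDerivAt (fun t => expCoeff (T t) (l t) (u t) m n)
      (T' * (Real.sqrt m * Real.sqrt n) * expCoeff (T t) (l t) (u t) (m - 1) (n - 1) +
        l' * Real.sqrt m * expCoeff (T t) (l t) (u t) (m - 1) n +
        u' * Real.sqrt n * expCoeff (T t) (l t) (u t) m (n - 1)) t := by
  induction m generalizing n with
  | zero =>
    have h := (hu.pow n).div_const (Real.sqrt n.factorial : ℂ)
    simp only [expCoeff]
    refine h.congr_deriv ?_
    rcases n with _ | n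
    · simp
    · have h1 := ofReal_sqrt_succ_ne_zero n
      have h2 := ofReal_sqrt_factorial_ne_zero n
      have hs := ofReal_sqrt_succ_sq n
      simp only [ofReal_sqrt_factorial_succ, Nat.add_sub_cancel, Nat.cast_zero, Real.sqrt_zero,
        Complex.ofReal_zero, Nat.cast_succ]
      field_simp
      linear_combination (-(u t ^ n * u')) * hs
  | succ m ih =>
    have hm := ofReal_sqrt_succ_ne_zero m
    have h := (((hT.mul_const (Real.sqrt n : ℂ)).mul (ih (n - 1))).add (hl.mul (ih n))).div_const
      (Real.sqrt (m + 1) : ℂ)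
    refine HasDerivAt.congr_deriv (f := fun t => expCoeff (T t) (l t) (u t) (m + 1) n) h ?_
    have e1 := nat_mul_expCoeff_left (T t) (l t) (u t) m n
    have e2 := nat_mul_expCoeff_left (T t) (l t) (u t) m (n - 1)
    have e3 := sqrt_mul_expCoeff_succ_left (T t) (l t) (u t) m (n - 1)
    have sm := ofReal_sqrt_succ_sq m
    rw [div_eq_iff hm]
    simp only [Nat.add_sub_cancel, Nat.cast_succ]
    linear_combination (-(T' * (Real.sqrt n : ℂ))) * e2 -
      T' * (Real.sqrt n : ℂ) * expCoeff (T t) (l t) (u t) m (n - 1) * sm - l' * e1 -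
      l' * expCoeff (T t) (l t) (u t) m n * sm - u' * (Real.sqrt n : ℂ) * e3

/-! ### Geometric decay of the amplitudes -/

/-- One step of the recursion, towards the larger index `p + 1`, preserves the bound
`C * r ^ (m + n)` as soon as `L ≤ (r ^ 2 - τ) * √(p + 1)`. -/
lemma geometric_step {τ r L C A B : ℝ} {x : ℂ} {p q : ℕ} (hτ : 0 ≤ τ) (hr : 0 < r) (hr1 : r < 1)
    (hL0 : 0 ≤ L) (hL : L ≤ (r ^ 2 - τ) * Real.sqrt (p + 1)) (hqp : q ≤ p + 1) (hC : 0 ≤ C)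
    (hA : 1 ≤ q → A ≤ C * r ^ (p + (q - 1))) (hB : B ≤ C * r ^ (p + q))
    (hx : Real.sqrt (p + 1) * ‖x‖ ≤ τ * Real.sqrt q * A + L * B) :
    ‖x‖ ≤ C * r ^ (p + 1 + q) := by
  have hs : 0 < Real.sqrt (p + 1) := Real.sqrt_pos.mpr (by positivity)
  have hqs : Real.sqrt q ≤ Real.sqrt (p + 1) := Real.sqrt_le_sqrt (by exact_mod_cast hqp)
  have hδ : 0 ≤ r ^ 2 - τ := by
    by_contra! h
    nlinarith
  have h2 : L * B ≤ (r ^ 2 - τ) * Real.sqrt (p + 1) * (C * r ^ (p + q)) :=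
    (mul_le_mul_of_nonneg_left hB hL0).trans (mul_le_mul_of_nonneg_right hL (by positivity))
  refine le_of_mul_le_mul_left (hx.trans ?_) hs
  rcases q with _ | q
  · have h3 : (r ^ 2 - τ) * (Real.sqrt (p + 1) * (C * r ^ p)) ≤
        r * (Real.sqrt (p + 1) * (C * r ^ p)) :=
      mul_le_mul_of_nonneg_right (by nlinarith) (by positivity)
    simp only [Nat.cast_zero, Real.sqrt_zero, add_zero, pow_succ] at h2 ⊢
    linarith
  · have h4 : τ * Real.sqrt (q + 1 : ℕ) * A ≤ τ * Real.sqrt (p + 1) * (C * r ^ (p + q)) :=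
      (mul_le_mul_of_nonneg_left (hA (by omega)) (by positivity)).trans
        (mul_le_mul_of_nonneg_right (mul_le_mul_of_nonneg_left hqs hτ) (by positivity))
    have h5 : (r ^ 2 - τ) * r * (Real.sqrt (p + 1) * (C * r ^ (p + q))) ≤
        (r ^ 2 - τ) * (Real.sqrt (p + 1) * (C * r ^ (p + q))) :=
      mul_le_mul_of_nonneg_right (mul_le_of_le_one_right hδ hr1.le) (by positivity)
    have e1 : r ^ (p + (q + 1)) = r ^ (p + q) * r := by ring
    have e2 : r ^ (p + 1 + (q + 1)) = r ^ (p + q) * r ^ 2 := by ring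
    rw [e1] at h2
    rw [e2]
    linarith

lemma norm_ofReal_sqrt (x : ℝ) : ‖(Real.sqrt x : ℂ)‖ = Real.sqrt x := by
  rw [Complex.norm_real, Real.norm_of_nonneg (Real.sqrt_nonneg _)]

lemma sqrt_mul_norm_expCoeff_succ_left_le {τ L : ℝ} {T l u : ℂ} (hT : ‖T‖ ≤ τ) (hl : ‖l‖ ≤ L)
    (m n : ℕ) : Real.sqrt (m + 1) * ‖expCoeff T l u (m + 1) n‖ ≤
      τ * Real.sqrt n * ‖expCoeff T l u m (n - 1)‖ + L * ‖expCoeff T l u m n‖ := by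
  have h := congrArg norm (sqrt_mul_expCoeff_succ_left T l u m n)
  rw [norm_mul, norm_ofReal_sqrt] at h
  rw [h]
  refine (norm_add_le _ _).trans ?_
  simp only [norm_mul, norm_ofReal_sqrt]
  gcongr

lemma sqrt_mul_norm_expCoeff_succ_right_le {τ L : ℝ} {T l u : ℂ} (hT : ‖T‖ ≤ τ) (hu : ‖u‖ ≤ L)
    (m n : ℕ) : Real.sqrt (n + 1) * ‖expCoeff T l u m (n + 1)‖ ≤
      τ * Real.sqrt m * ‖expCoeff T l u (m - 1) n‖ + L * ‖expCoeff T l u m n‖ := by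
  have h := congrArg norm (sqrt_mul_expCoeff_succ_right T l u m n)
  rw [norm_mul, norm_ofReal_sqrt] at h
  rw [h]
  refine (norm_add_le _ _).trans ?_
  simp only [norm_mul, norm_ofReal_sqrt]
  gcongr

lemma exists_norm_expCoeff_le (τ L : ℝ) (hτ : 0 ≤ τ) (hL : 0 ≤ L) (m n : ℕ) :
    ∃ C : ℝ, 0 ≤ C ∧ ∀ T l u : ℂ, ‖T‖ ≤ τ → ‖l‖ ≤ L → ‖u‖ ≤ L → ‖expCoeff T l u m n‖ ≤ C := by
  induction m generalizing n with
  | zero =>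
    refine ⟨L ^ n / Real.sqrt n.factorial, by positivity, fun T l u _ _ hu => ?_⟩
    rw [expCoeff, norm_div, norm_pow, norm_ofReal_sqrt]
    gcongr
  | succ m ih =>
    obtain ⟨C₁, h₁, H₁⟩ := ih (n - 1)
    obtain ⟨C₂, h₂, H₂⟩ := ih n
    refine ⟨(τ * Real.sqrt n * C₁ + L * C₂) / Real.sqrt (m + 1), by positivity,
      fun T l u hT hl hu => ?_⟩
    rw [le_div_iff₀' (Real.sqrt_pos.mpr (by positivity))]
    refine (sqrt_mul_norm_expCoeff_succ_left_le hT hl m n).trans ?_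
    gcongr
    · exact H₁ T l u hT hl hu
    · exact H₂ T l u hT hl hu

/-- The amplitudes decay geometrically, locally uniformly in the parameters with `‖T‖ < 1`. Past a
finite set of indices the bound propagates along the recursion that lowers the larger index:
there the factors `√n / √(m + 1)` are at most `1` and `l / √(m + 1)` is small. -/
theorem exists_norm_expCoeff_le_geometric {τ L : ℝ} (hτ : 0 ≤ τ) (hτ1 : τ < 1) (hL : 0 ≤ L) :
    ∃ C r : ℝ, 0 ≤ C ∧ 0 < r ∧ r < 1 ∧ ∀ T l u : ℂ, ‖T‖ ≤ τ → ‖l‖ ≤ L → ‖u‖ ≤ L →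
      ∀ m n, ‖expCoeff T l u m n‖ ≤ C * r ^ (m + n) := by
  -- The step lemma needs `τ < r ^ 2`; this holds because `r ^ 2 - τ = ((1 - τ) / 2) ^ 2`.
  set r : ℝ := (1 + τ) / 2 with hr
  have hr0 : 0 < r := by positivity
  have hr1 : r < 1 := by linarith
  have hδ : 0 < r ^ 2 - τ := by rw [hr]; nlinarith [sq_pos_of_pos (sub_pos.mpr hτ1)]
  obtain ⟨K, hK⟩ := exists_nat_ge ((L / (r ^ 2 - τ)) ^ 2)
  have hLp : ∀ p : ℕ, K ≤ p + 1 → L ≤ (r ^ 2 - τ) * Real.sqrt (p + 1) := by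
    intro p hp
    rw [← div_le_iff₀' hδ]
    refine Real.le_sqrt_of_sq_le (hK.trans ?_)
    exact_mod_cast hp
  choose c hc0 hc using exists_norm_expCoeff_le τ L hτ hL
  set S : Finset (ℕ × ℕ) := Finset.range (2 * K + 1) ×ˢ Finset.range (2 * K + 1)
  set C : ℝ := (∑ k ∈ S, c k.1 k.2) / r ^ (2 * K) with hCdef
  have hsum : 0 ≤ ∑ k ∈ S, c k.1 k.2 := Finset.sum_nonneg fun k _ => hc0 _ _
  have hC0 : 0 ≤ C := by positivity
  refine ⟨C, r, hC0, hr0, hr1, fun T l u hT hl hu => ?_⟩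
  suffices h : ∀ N m n, m + n = N → ‖expCoeff T l u m n‖ ≤ C * r ^ (m + n) from
    fun m n => h _ m n rfl
  intro N
  induction N using Nat.strong_induction_on with
  | _ N ih =>
  intro m n hmn
  by_cases hN : N ≤ 2 * K
  · have hmem : (m, n) ∈ S := by
      simp only [S, Finset.mem_product, Finset.mem_range]; omega
    refine (hc m n T l u hT hl hu).trans ((Finset.single_le_sum
      (f := fun k : ℕ × ℕ => c k.1 k.2) (fun k _ => hc0 _ _) hmem).trans ?_)
    rw [hCdef, div_mul_eq_mul_div, le_div_iff₀ (by positivity)]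
    exact mul_le_mul_of_nonneg_left
      (pow_le_pow_of_le_one hr0.le hr1.le (by omega)) hsum
  · rcases le_or_gt n m with h | h
    · obtain ⟨p, rfl⟩ : ∃ p, m = p + 1 := ⟨m - 1, by omega⟩
      exact geometric_step hτ hr0 hr1 hL (hLp p (by omega)) h hC0
        (fun _ => ih (p + (n - 1)) (by omega) p (n - 1) rfl)
        (ih (p + n) (by omega) p n rfl) (sqrt_mul_norm_expCoeff_succ_left_le hT hl p n)
    · obtain ⟨p, rfl⟩ : ∃ p, n = p + 1 := ⟨n - 1, by omega⟩
      rw [add_comm m]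
      refine geometric_step hτ hr0 hr1 hL (hLp p (by omega)) h.le hC0
        (fun _ => ?_) ?_ (sqrt_mul_norm_expCoeff_succ_right_le hT hu m p)
      · rw [add_comm p]
        exact ih (m - 1 + p) (by omega) (m - 1) p rfl
      · rw [add_comm p]
        exact ih (m + p) (by omega) m p rfl

/-! ### Dominated convergence in the Fock space -/

lemma norm_sq_eq_tsum (f : TwoModeFock) : ‖f‖ ^ 2 = ∑' k, ‖f k‖ ^ 2 := by
  have h := lp.norm_rpow_eq_tsum (p := 2) (by norm_num) f
  simpa using h

lemma tendsto_of_dominated {ι : Type*} {𝓕 : Filter ι} {F : ι → TwoModeFock} {f : TwoModeFock}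
    {B : ℕ × ℕ → ℝ} (hB : Memℓp B 2) (hF : ∀ᶠ i in 𝓕, ∀ k, ‖F i k‖ ≤ B k)
    (hf : ∀ k, ‖f k‖ ≤ B k) (h : ∀ k, Filter.Tendsto (fun i => F i k) 𝓕 (nhds (f k))) :
    Filter.Tendsto F 𝓕 (nhds f) := by
  have hs : Summable fun k => (2 * B k) ^ 2 := by
    have := (hB.summable (by norm_num)).mul_left 4
    refine this.congr fun k => ?_
    simp [mul_pow]; norm_num
  have key : Filter.Tendsto (fun i => ∑' k, ‖(F i - f) k‖ ^ 2) 𝓕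
      (nhds (∑' _ : ℕ × ℕ, (0 : ℝ))) := by
    refine tendsto_tsum_of_dominated_convergence hs (fun k => ?_) ?_
    · have h1 := ((h k).sub_const (f k)).norm.pow 2
      simpa using h1
    · filter_upwards [hF] with i hi k
      rw [Real.norm_of_nonneg (by positivity)]
      have h2 : ‖(F i - f) k‖ ≤ 2 * B k :=
        (norm_sub_le (F i k) (f k)).trans (by linarith [hi k, hf k])
      gcongr
  rw [tendsto_iff_norm_sub_tendsto_zero]
  simp_rw [← norm_sq_eq_tsum] at key
  have h3 := key.sqrt
  simpa using h3

/-- The geometric profile `C (m + 1) rᵐ (n + 1) rⁿ`, which dominates the amplitudes of the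
exponential vectors together with the square roots that the ladder operators contribute. -/
noncomputable def geometricProfile (C r : ℝ) (k : ℕ × ℕ) : ℝ :=
  C * (((k.1 + 1) * r ^ k.1) * ((k.2 + 1) * r ^ k.2))

lemma memℓp_geometricProfile (C : ℝ) {r : ℝ} (hr : 0 < r) (hr1 : r < 1) :
    Memℓp (geometricProfile C r) 2 := by
  have h1 : Summable fun n : ℕ => (((n : ℝ) + 1) * r ^ n) ^ 2 := by
    have hq : ‖r ^ 2‖ < 1 := by
      rw [Real.norm_of_nonneg (by positivity)]; nlinarith
    have a0 := summable_pow_mul_geometric_of_norm_lt_one 0 hq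
    have a1 := summable_pow_mul_geometric_of_norm_lt_one 1 hq
    have a2 := summable_pow_mul_geometric_of_norm_lt_one 2 hq
    refine ((a2.add (a1.mul_left 2)).add a0).congr fun n => ?_
    ring
  have h2 := (h1.mul_of_nonneg h1 (fun _ => by positivity) (fun _ => by positivity)).mul_left
    (C ^ 2)
  refine memℓp_gen (h2.congr fun k => ?_)
  simp only [geometricProfile, ENNReal.toReal_ofNat, Real.rpow_ofNat, Real.norm_eq_abs, sq_abs]
  ring

/-! ### Weighted shifts -/

/-- An operator on the two-mode amplitudes of the form `f ↦ (k ↦ weight k * f (source k))`, with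
the growth of a ladder operator of each mode. The ladder operators and the products `a† b†`, `a b`
have this form. -/
structure WeightedShift where
  /-- The factor at `k`. -/
  weight : ℕ × ℕ → ℝ
  /-- The index from which the amplitude at `k` is taken. -/
  source : ℕ × ℕ → ℕ × ℕ
  abs_weight_le : ∀ k, |weight k| ≤ (k.1 + 1) * (k.2 + 1)
  le_source_fst : ∀ k, k.1 ≤ (source k).1 + 1
  le_source_snd : ∀ k, k.2 ≤ (source k).2 + 1

namespace WeightedShift

/-- The amplitudes of the image under the weighted shift. -/
noncomputable def apply (S : WeightedShift) (f : ℕ × ℕ → ℂ) (k : ℕ × ℕ) : ℂ :=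
  (S.weight k : ℂ) * f (S.source k)

lemma norm_apply_le (S : WeightedShift) {f : ℕ × ℕ → ℂ} {C r : ℝ} (hC : 0 ≤ C) (hr : 0 < r)
    (hr1 : r < 1) (hf : ∀ k, ‖f k‖ ≤ C * r ^ (k.1 + k.2)) (k : ℕ × ℕ) :
    ‖S.apply f k‖ ≤ geometricProfile (C / r ^ 2) r k := by
  have h1 : r ^ ((S.source k).1 + (S.source k).2) ≤ r ^ (k.1 + k.2) / r ^ 2 := by
    rw [le_div_iff₀ (by positivity), ← pow_add]
    have := S.le_source_fst k
    have := S.le_source_snd k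
    exact pow_le_pow_of_le_one hr.le hr1.le (by omega)
  rw [apply, norm_mul, Complex.norm_real, Real.norm_eq_abs, geometricProfile]
  calc |S.weight k| * ‖f (S.source k)‖
      ≤ ((k.1 + 1) * (k.2 + 1)) * (C * (r ^ (k.1 + k.2) / r ^ 2)) := by
        refine mul_le_mul (S.abs_weight_le k) ((hf _).trans ?_) (norm_nonneg _) (by positivity)
        gcongr
    _ = _ := by rw [pow_add]; ring

/-- The identity. -/
def id : WeightedShift where
  weight _ := 1
  source k := k
  abs_weight_le k := by
    rw [abs_one]
    nlinarith [Nat.cast_nonneg (α := ℝ) k.1, Nat.cast_nonneg (α := ℝ) k.2,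
      mul_nonneg (Nat.cast_nonneg (α := ℝ) k.1) (Nat.cast_nonneg (α := ℝ) k.2)]
  le_source_fst _ := by omega
  le_source_snd _ := by omega

lemma abs_sqrt_le {x : ℝ} {m : ℕ} (h : x ≤ m + 1) : |Real.sqrt x| ≤ m + 1 := by
  rw [abs_of_nonneg (Real.sqrt_nonneg _)]
  exact Real.sqrt_le_iff.mpr ⟨by positivity, by nlinarith [Nat.cast_nonneg (α := ℝ) m]⟩

lemma le_mul_right_weight {x : ℝ} {m : ℕ} (n : ℕ) (h : x ≤ m + 1) : x ≤ (m + 1) * (n + 1) := by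
  nlinarith [Nat.cast_nonneg (α := ℝ) m, Nat.cast_nonneg (α := ℝ) n,
    mul_nonneg (Nat.cast_nonneg (α := ℝ) m) (Nat.cast_nonneg (α := ℝ) n)]

lemma le_mul_left_weight {x : ℝ} (m : ℕ) {n : ℕ} (h : x ≤ n + 1) : x ≤ (m + 1) * (n + 1) := by
  rw [mul_comm]; exact le_mul_right_weight m h

/-- `a†`. -/
noncomputable def creA : WeightedShift where
  weight k := Real.sqrt k.1
  source k := (k.1 - 1, k.2)
  abs_weight_le _ := le_mul_right_weight _ (abs_sqrt_le (by linarith))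
  le_source_fst _ := by dsimp only; omega
  le_source_snd _ := by dsimp only; omega

/-- `a`. -/
noncomputable def annA : WeightedShift where
  weight k := Real.sqrt (k.1 + 1)
  source k := (k.1 + 1, k.2)
  abs_weight_le _ := le_mul_right_weight _ (abs_sqrt_le le_rfl)
  le_source_fst _ := by dsimp only; omega
  le_source_snd _ := by dsimp only; omega

/-- `b†`. -/
noncomputable def creB : WeightedShift where
  weight k := Real.sqrt k.2
  source k := (k.1, k.2 - 1)
  abs_weight_le _ := le_mul_left_weight _ (abs_sqrt_le (by linarith))
  le_source_fst _ := by dsimp only; omega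
  le_source_snd _ := by dsimp only; omega

/-- `b`. -/
noncomputable def annB : WeightedShift where
  weight k := Real.sqrt (k.2 + 1)
  source k := (k.1, k.2 + 1)
  abs_weight_le _ := le_mul_left_weight _ (abs_sqrt_le le_rfl)
  le_source_fst _ := by dsimp only; omega
  le_source_snd _ := by dsimp only; omega

/-- `a† b†`. -/
noncomputable def creAB : WeightedShift where
  weight k := Real.sqrt k.1 * Real.sqrt k.2
  source k := (k.1 - 1, k.2 - 1)
  abs_weight_le _ := by
    rw [abs_mul]
    exact mul_le_mul (abs_sqrt_le (by linarith)) (abs_sqrt_le (by linarith)) (abs_nonneg _)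
      (by positivity)
  le_source_fst _ := by dsimp only; omega
  le_source_snd _ := by dsimp only; omega

/-- `a b`. -/
noncomputable def annAB : WeightedShift where
  weight k := Real.sqrt (k.1 + 1) * Real.sqrt (k.2 + 1)
  source k := (k.1 + 1, k.2 + 1)
  abs_weight_le _ := by
    rw [abs_mul]
    exact mul_le_mul (abs_sqrt_le le_rfl) (abs_sqrt_le le_rfl) (abs_nonneg _) (by positivity)
  le_source_fst _ := by dsimp only; omega
  le_source_snd _ := by dsimp only; omega

/-- The operator `A` on the finite combinations of Fock states acts as the weighted shift `S`. -/
def Represents (S : WeightedShift) (A : Module.End ℂ FiniteFock) : Prop :=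
  ∀ v k, A v k = S.apply v k

lemma Represents.of_single {S : WeightedShift} {A : Module.End ℂ FiniteFock}
    (h : ∀ j k, A (Finsupp.single j 1) k = S.apply (Finsupp.single j 1) k) : S.Represents A := by
  intro v k
  induction v using Finsupp.induction_linear with
  | zero => simp [apply]
  | add v w hv hw => simp only [map_add, Finsupp.add_apply, hv, hw, apply]; ring
  | single j c =>
    have e : Finsupp.single j c = c • (Finsupp.single j 1 : FiniteFock) := by simp
    rw [e, map_smul, Finsupp.smul_apply, h]
    simp only [apply, Finsupp.smul_apply, smul_eq_mul]
    ring

lemma represents_one : id.Represents 1 := fun v k => by simp [apply, id]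

lemma represents_creA : creA.Represents _root_.creA := by
  refine .of_single fun j k => ?_
  obtain ⟨m, n⟩ := j
  obtain ⟨p, q⟩ := k
  simp only [_root_.creA, Finsupp.linearCombination_single, one_smul, apply, creA,
    Finsupp.single_apply, Prod.mk.injEq]
  rcases p with _ | p
  · simp
  · by_cases h : m = p ∧ n = q
    · obtain ⟨rfl, rfl⟩ := h; simp
    · simp [h]

lemma represents_creB : creB.Represents _root_.creB := by
  refine .of_single fun j k => ?_
  obtain ⟨m, n⟩ := j
  obtain ⟨p, q⟩ := k
  simp only [_root_.creB, Finsupp.linearCombination_single, one_smul, apply, creB,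
    Finsupp.single_apply, Prod.mk.injEq]
  rcases q with _ | q
  · simp
  · by_cases h : m = p ∧ n = q
    · obtain ⟨rfl, rfl⟩ := h; simp
    · simp [h]

lemma represents_annA : annA.Represents _root_.annA := by
  refine .of_single fun j k => ?_
  obtain ⟨m, n⟩ := j
  obtain ⟨p, q⟩ := k
  simp only [_root_.annA, Finsupp.linearCombination_single, one_smul, apply, annA,
    Finsupp.single_apply, Prod.mk.injEq]
  rcases m with _ | m
  · simp
  · by_cases h : m = p ∧ n = q
    · obtain ⟨rfl, rfl⟩ := h; simp
    · simp [h]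

lemma represents_annB : annB.Represents _root_.annB := by
  refine .of_single fun j k => ?_
  obtain ⟨m, n⟩ := j
  obtain ⟨p, q⟩ := k
  simp only [_root_.annB, Finsupp.linearCombination_single, one_smul, apply, annB,
    Finsupp.single_apply, Prod.mk.injEq]
  rcases n with _ | n
  · simp
  · by_cases h : m = p ∧ n = q
    · obtain ⟨rfl, rfl⟩ := h; simp
    · simp [h]

lemma represents_creAB : creAB.Represents (_root_.creA * _root_.creB) := by
  intro v k
  rw [Module.End.mul_apply, represents_creA]
  simp only [apply, represents_creB _ _, creA, creB, creAB]
  push_cast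
  ring

lemma represents_annAB : annAB.Represents (_root_.annA * _root_.annB) := by
  intro v k
  rw [Module.End.mul_apply, represents_annA]
  simp only [apply, represents_annB _ _, annA, annB, annAB]
  push_cast
  ring

end WeightedShift

/-! ### Exponential vectors -/

/-- The amplitudes of the exponential vector as a function on `ℕ × ℕ`. -/
noncomputable def expAmp (T l u : ℂ) (k : ℕ × ℕ) : ℂ := expCoeff T l u k.1 k.2

lemma exists_norm_apply_expAmp_le {τ L : ℝ} (hτ : 0 ≤ τ) (hτ1 : τ < 1) (hL : 0 ≤ L) :
    ∃ B : ℕ × ℕ → ℝ, Memℓp B 2 ∧ ∀ (S : WeightedShift) (T l u : ℂ), ‖T‖ ≤ τ → ‖l‖ ≤ L → ‖u‖ ≤ L →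
      ∀ k, ‖S.apply (expAmp T l u) k‖ ≤ B k := by
  obtain ⟨C, r, hC, hr, hr1, h⟩ := exists_norm_expCoeff_le_geometric hτ hτ1 hL
  exact ⟨geometricProfile (C / r ^ 2) r, memℓp_geometricProfile _ hr hr1,
    fun S T l u hT hl hu => S.norm_apply_le hC hr hr1 fun k => h T l u hT hl hu k.1 k.2⟩

lemma memℓp_apply_expAmp (S : WeightedShift) {T : ℂ} (l u : ℂ) (hT : ‖T‖ < 1) :
    Memℓp (S.apply (expAmp T l u)) 2 := by
  obtain ⟨B, hB, h⟩ := exists_norm_apply_expAmp_le (norm_nonneg T) hT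
    (le_max_of_le_left (norm_nonneg l) : 0 ≤ max ‖l‖ ‖u‖)
  exact hB.mono' fun k => (h S T l u le_rfl (le_max_left _ _) (le_max_right _ _) k).trans
    (le_abs_self _)

/-- The image of the exponential vector `exp (T a† b† + l a† + u b†) |0, 0⟩` under a weighted
shift. It lies in the Fock space because the amplitudes decay geometrically when `‖T‖ < 1`. -/
noncomputable def WeightedShift.expVec (S : WeightedShift) (T l u : ℂ) (hT : ‖T‖ < 1) :
    TwoModeFock :=
  ⟨S.apply (expAmp T l u), memℓp_apply_expAmp S l u hT⟩

lemma WeightedShift.expVec_apply (S : WeightedShift) (T l u : ℂ) (hT : ‖T‖ < 1) (k : ℕ × ℕ) :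
    S.expVec T l u hT k = S.apply (expAmp T l u) k := rfl

/-- The exponential vector `exp (T a† b† + l a† + u b†) |0, 0⟩`. -/
noncomputable abbrev expVec (T l u : ℂ) (hT : ‖T‖ < 1) : TwoModeFock :=
  WeightedShift.id.expVec T l u hT

lemma expVec_apply (T l u : ℂ) (hT : ‖T‖ < 1) (k : ℕ × ℕ) :
    expVec T l u hT k = expCoeff T l u k.1 k.2 := by
  rw [WeightedShift.expVec_apply]
  simp [WeightedShift.apply, WeightedShift.id, expAmp]

lemma WeightedShift.continuous_expVec (S : WeightedShift) {T l u : ℝ → ℂ} (hT : ∀ t, ‖T t‖ < 1)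
    (cT : Continuous T) (cl : Continuous l) (cu : Continuous u)
    (hc : ∀ m n, Continuous fun t => expCoeff (T t) (l t) (u t) m n) :
    Continuous fun t => S.expVec (T t) (l t) (u t) (hT t) := by
  rw [continuous_iff_continuousAt]
  intro t₀
  obtain ⟨τ, hτ, hτ1⟩ := exists_between (hT t₀)
  set L : ℝ := max ‖l t₀‖ ‖u t₀‖ + 1
  have hl : ‖l t₀‖ < L := (le_max_left _ _).trans_lt (lt_add_one _)
  have hu : ‖u t₀‖ < L := (le_max_right _ _).trans_lt (lt_add_one _)
  obtain ⟨B, hB, h⟩ := exists_norm_apply_expAmp_le ((norm_nonneg _).trans hτ.le) hτ1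
    ((norm_nonneg _).trans hl.le)
  refine tendsto_of_dominated hB ?_ (h S _ _ _ hτ.le hl.le hu.le) fun k => ?_
  · filter_upwards [(cT.norm.tendsto t₀).eventually_lt_const hτ,
      (cl.norm.tendsto t₀).eventually_lt_const hl,
      (cu.norm.tendsto t₀).eventually_lt_const hu] with t h1 h2 h3
    exact h S _ _ _ h1.le h2.le h3.le
  · exact ((hc _ _).tendsto t₀).const_mul _

/-! ### The closed graph -/

lemma toFock_apply (v : FiniteFock) (k : ℕ × ℕ) : toFock v k = v k := by
  induction v using Finsupp.induction_linear with
  | zero => simp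
  | add v w hv hw => rw [map_add, lp.coeFn_add, Pi.add_apply, hv, hw, Finsupp.add_apply]
  | single j c =>
    rw [toFock, Finsupp.linearCombination_single, lp.coeFn_smul, Pi.smul_apply, fockState,
      lp.single_apply, Finsupp.single_apply, smul_eq_mul]
    by_cases h : j = k
    · subst h; simp
    · rw [Pi.single_eq_of_ne (Ne.symm h)]; simp [h]

/-- The truncation of a family of amplitudes to the photon numbers below `N`. -/
noncomputable def truncate (f : ℕ × ℕ → ℂ) (N : ℕ) : FiniteFock :=
  Finsupp.indicator (Finset.range N ×ˢ Finset.range N) fun k _ => f k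

lemma truncate_apply_of_lt (f : ℕ × ℕ → ℂ) {N : ℕ} {k : ℕ × ℕ} (h1 : k.1 < N) (h2 : k.2 < N) :
    truncate f N k = f k := by
  rw [truncate, Finsupp.indicator_of_mem]
  simp [h1, h2]

lemma norm_truncate_le (f : ℕ × ℕ → ℂ) (N : ℕ) (k : ℕ × ℕ) : ‖truncate f N k‖ ≤ ‖f k‖ := by
  by_cases h : k ∈ Finset.range N ×ˢ Finset.range N
  · rw [truncate, Finsupp.indicator_of_mem h]
  · rw [truncate, Finsupp.indicator_of_notMem h, norm_zero]; exact norm_nonneg _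

lemma WeightedShift.Represents.tendsto_truncate {S : WeightedShift} {A : Module.End ℂ FiniteFock}
    (hA : S.Represents A) (T l u : ℂ) (hT : ‖T‖ < 1) :
    Filter.Tendsto (fun N => toFock (A (truncate (expAmp T l u) N))) Filter.atTop
      (nhds (S.expVec T l u hT)) := by
  obtain ⟨B, hB, h⟩ := exists_norm_apply_expAmp_le (norm_nonneg T) hT
    (le_max_of_le_left (norm_nonneg l) : 0 ≤ max ‖l‖ ‖u‖)
  have hle := h S T l u le_rfl (le_max_left _ _) (le_max_right _ _)
  refine tendsto_of_dominated hB (Filter.Eventually.of_forall fun N k => ?_) hle fun k => ?_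
  · refine le_trans ?_ (hle k)
    rw [toFock_apply, hA, WeightedShift.apply, WeightedShift.apply, norm_mul, norm_mul]
    exact mul_le_mul_of_nonneg_left (norm_truncate_le _ _ _) (norm_nonneg _)
  · refine tendsto_const_nhds.congr' ?_
    filter_upwards [Filter.eventually_gt_atTop (S.source k).1,
      Filter.eventually_gt_atTop (S.source k).2] with N h1 h2
    rw [toFock_apply, hA, WeightedShift.apply, truncate_apply_of_lt _ h1 h2]
    rfl

/-- The exponential vectors are in the domain of the closure of a combination of ladder operators,
which acts on them coordinatewise. -/
lemma expVec_mem_closedGraph {S₁ S₂ : WeightedShift} {A₁ A₂ : Module.End ℂ FiniteFock}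
    (h₁ : S₁.Represents A₁) (h₂ : S₂.Represents A₂) (z w T l u : ℂ) (hT : ‖T‖ < 1) :
    (expVec T l u hT, z • S₁.expVec T l u hT - w • S₂.expVec T l u hT) ∈
      closedGraph (z • A₁ - w • A₂) := by
  refine mem_closure_of_tendsto
    ((WeightedShift.represents_one.tendsto_truncate T l u hT).prodMk_nhds
      (((h₁.tendsto_truncate T l u hT).const_smul z).sub
      ((h₂.tendsto_truncate T l u hT).const_smul w))) (Filter.Eventually.of_forall fun N => ?_)
  exact ⟨truncate (expAmp T l u) N, by simp⟩

/-! ### Explicit mild solutions -/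

lemma integral_mem_of_isClosed {E : Type*} [NormedAddCommGroup E] [NormedSpace ℂ E]
    [CompleteSpace E] (K : Submodule ℂ E) (hK : IsClosed (K : Set E)) {f : ℝ → E}
    (hf : Continuous f) (hm : ∀ t, f t ∈ K) (a b : ℝ) : (∫ t in a..b, f t) ∈ K := by
  have : CompleteSpace K := hK.completeSpace_coe
  have hc : Continuous fun t => (⟨f t, hm t⟩ : K) := hf.subtype_mk hm
  have h := K.subtypeL.intervalIntegral_comp_comm
    (hc.intervalIntegrable (μ := MeasureTheory.volume) a b)
  have e : (∫ t in a..b, f t) = K.subtypeL (∫ t in a..b, (⟨f t, hm t⟩ : K)) := h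
  rw [e]
  exact Subtype.mem _

lemma re_inner_eq_zero_of_mem_closedGraph {A : Module.End ℂ FiniteFock}
    (hA : ∀ v : FiniteFock, (⟪toFock v, toFock (A v)⟫_ℂ).re = 0) {p : TwoModeFock × TwoModeFock}
    (hp : p ∈ closedGraph A) : (⟪p.1, p.2⟫_ℂ).re = 0 := by
  have hc : IsClosed {p : TwoModeFock × TwoModeFock | (⟪p.1, p.2⟫_ℂ).re = 0} :=
    isClosed_eq (Complex.continuous_re.comp (continuous_fst.inner continuous_snd)) continuous_const
  refine closure_minimal ?_ hc hp
  rintro _ ⟨v, rfl⟩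
  exact hA v

/-- A curve that is differentiable in each coordinate, with a derivative that is continuous in
norm and is the image of the curve under the closure of `A`, is the orbit `exp (t A)`; it has
constant norm. -/
theorem expOp_eq_of_curve {A : Module.End ℂ FiniteFock}
    (hA : ∀ v : FiniteFock, (⟪toFock v, toFock (A v)⟫_ℂ).re = 0) {φ v : ℝ → TwoModeFock}
    (hφ : Continuous φ) (hv : Continuous v) (hmem : ∀ t, (φ t, v t) ∈ closedGraph A)
    (hd : ∀ t k, HasDerivAt (fun t => φ t k) (v t k) t) :
    expOp A (φ 0) = φ 1 ∧ ‖φ 1‖ = ‖φ 0‖ := by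
  have hint : ∀ t, (∫ s in (0 : ℝ)..t, v s) = φ t - φ 0 := by
    intro t
    ext k
    have h1 := (lp.evalCLM ℂ (fun _ : ℕ × ℕ => ℂ) 2 k).intervalIntegral_comp_comm
      (hv.intervalIntegrable (μ := MeasureTheory.volume) 0 t)
    have h2 : ∫ s in (0 : ℝ)..t, (v s) k = φ t k - φ 0 k :=
      intervalIntegral.integral_eq_sub_of_hasDerivAt (fun s _ => hd s k)
        (((lp.evalCLM ℂ (fun _ : ℕ × ℕ => ℂ) 2 k).continuous.comp hv).intervalIntegrable _ _)
    exact h1.symm.trans h2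
  have hmild : IsMildSolution A (φ 0) φ := by
    refine ⟨hφ, fun t => ?_⟩
    have h := integral_mem_of_isClosed (closedGraph A) (Submodule.isClosed_topologicalClosure _)
      (hφ.prodMk hv) hmem 0 t
    have hi := (hφ.prodMk hv).intervalIntegrable (μ := MeasureTheory.volume) 0 t
    have e1 := (ContinuousLinearMap.fst ℂ TwoModeFock TwoModeFock).intervalIntegral_comp_comm hi
    have e2 := (ContinuousLinearMap.snd ℂ TwoModeFock TwoModeFock).intervalIntegral_comp_comm hi
    rw [← hint t]
    have e : ((∫ s in (0 : ℝ)..t, φ s), ∫ s in (0 : ℝ)..t, v s) =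
        ∫ s in (0 : ℝ)..t, (φ s, v s) := Prod.ext e1 e2
    rw [e]
    exact h
  constructor
  · have hex : ∃ u, IsMildSolution A (φ 0) u := ⟨φ, hmild⟩
    rw [expOp, dif_pos hex, IsMildSolution.unique hA hex.choose_spec hmild]
  · have hφd : ∀ t, HasDerivAt φ (v t) t := by
      intro t
      have h := (intervalIntegral.integral_hasDerivAt_right (hv.intervalIntegrable 0 t)
        hv.stronglyMeasurable.stronglyMeasurableAtFilter hv.continuousAt).add_const (φ 0)
      refine h.congr_of_eventuallyEq (Filter.Eventually.of_forall fun s => ?_)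
      simp [hint s]
    have hn : ∀ t, HasDerivAt (fun t => ‖φ t‖ ^ 2) 0 t := by
      intro t
      have h2 := Complex.reCLM.hasFDerivAt.comp_hasDerivAt t ((hφd t).inner ℂ (hφd t))
      have k1 : (⟪φ t, v t⟫_ℂ).re = 0 := re_inner_eq_zero_of_mem_closedGraph hA (hmem t)
      have k2 : (⟪v t, φ t⟫_ℂ).re = 0 := by
        rw [← inner_conj_symm, Complex.conj_re]; exact k1
      have e1 : (fun t => ‖φ t‖ ^ 2) = Complex.reCLM ∘ fun t => ⟪φ t, φ t⟫_ℂ := by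
        funext s
        simp [inner_self_eq_norm_sq_to_K, ← Complex.ofReal_pow]
      have e2 : Complex.reCLM (⟪φ t, v t⟫_ℂ + ⟪v t, φ t⟫_ℂ) = 0 := by
        simp [Complex.add_re, k1, k2]
      rw [e1, ← e2]
      exact h2
    have h := is_const_of_deriv_eq_zero (fun t => (hn t).differentiableAt)
      (fun t => (hn t).deriv) 1 0
    exact (sq_eq_sq₀ (norm_nonneg _) (norm_nonneg _)).mp h

/-- The orbit of an exponential vector whose scalar factor `c` and parameters `T, l, u` vary: it is
enough that the derivative of the curve is given by the generator. -/
theorem expOp_eq_of_expVec_curve {A : Module.End ℂ FiniteFock}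
    (hA : ∀ v : FiniteFock, (⟪toFock v, toFock (A v)⟫_ℂ).re = 0)
    {c T l u c' T' l' u' : ℝ → ℂ} (hT1 : ∀ t, ‖T t‖ < 1)
    (hc : ∀ t, HasDerivAt c (c' t) t) (hT : ∀ t, HasDerivAt T (T' t) t)
    (hl : ∀ t, HasDerivAt l (l' t) t) (hu : ∀ t, HasDerivAt u (u' t) t)
    (cc' : Continuous c') (cT' : Continuous T') (cl' : Continuous l') (cu' : Continuous u')
    (hmem : ∀ t, (c t • expVec (T t) (l t) (u t) (hT1 t),
      c' t • expVec (T t) (l t) (u t) (hT1 t) +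
        c t • (T' t • WeightedShift.creAB.expVec (T t) (l t) (u t) (hT1 t) +
          l' t • WeightedShift.creA.expVec (T t) (l t) (u t) (hT1 t) +
          u' t • WeightedShift.creB.expVec (T t) (l t) (u t) (hT1 t))) ∈ closedGraph A) :
    expOp A (c 0 • expVec (T 0) (l 0) (u 0) (hT1 0)) =
        c 1 • expVec (T 1) (l 1) (u 1) (hT1 1) ∧
      ‖c 1 • expVec (T 1) (l 1) (u 1) (hT1 1)‖ = ‖c 0 • expVec (T 0) (l 0) (u 0) (hT1 0)‖ := by
  have cc : Continuous c := continuous_iff_continuousAt.mpr fun t => (hc t).continuousAt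
  have cT : Continuous T := continuous_iff_continuousAt.mpr fun t => (hT t).continuousAt
  have cl : Continuous l := continuous_iff_continuousAt.mpr fun t => (hl t).continuousAt
  have cu : Continuous u := continuous_iff_continuousAt.mpr fun t => (hu t).continuousAt
  have ce : ∀ m n, Continuous fun t => expCoeff (T t) (l t) (u t) m n := fun m n =>
    continuous_iff_continuousAt.mpr fun t =>
      (hasDerivAt_expCoeff (hT t) (hl t) (hu t) m n).continuousAt
  have cS : ∀ S : WeightedShift, Continuous fun t => S.expVec (T t) (l t) (u t) (hT1 t) :=
    fun S => S.continuous_expVec hT1 cT cl cu ce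
  refine expOp_eq_of_curve hA (φ := fun t => c t • expVec (T t) (l t) (u t) (hT1 t))
    (cc.smul (cS _)) ((cc'.smul (cS _)).add (cc.smul (((cT'.smul (cS _)).add (cl'.smul (cS _))).add
      (cu'.smul (cS _))))) hmem fun t k => ?_
  have h := (hc t).mul (hasDerivAt_expCoeff (hT t) (hl t) (hu t) k.1 k.2)
  have e : (fun t => (c t • expVec (T t) (l t) (u t) (hT1 t)) k) =
      fun t => c t * expCoeff (T t) (l t) (u t) k.1 k.2 := by
    funext s
    rw [lp.coeFn_smul, Pi.smul_apply, expVec_apply, smul_eq_mul]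
  rw [e]
  refine HasDerivAt.congr_deriv h ?_
  simp only [lp.coeFn_add, lp.coeFn_smul, Pi.add_apply, Pi.smul_apply, Pi.smul_apply',
    smul_eq_mul, WeightedShift.expVec_apply, WeightedShift.apply, WeightedShift.id,
    WeightedShift.creA, WeightedShift.creB, WeightedShift.creAB, expAmp]
  push_cast
  ring

/-! ### Skew-symmetry of the generators -/

lemma inner_toFock_single_left (j : ℕ × ℕ) (c : ℂ) (φ : TwoModeFock) :
    ⟪toFock (Finsupp.single j c), φ⟫_ℂ = (starRingEnd ℂ) c * φ j := by
  rw [toFock, Finsupp.linearCombination_single, inner_smul_left, fockState, lp.inner_single_left]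
  simp

/-- `D` is the formal adjoint of `C` on the finite combinations of Fock states. -/
def IsFormalAdjoint (C D : Module.End ℂ FiniteFock) : Prop :=
  ∀ v w, ⟪toFock v, toFock (C w)⟫_ℂ = ⟪toFock (D v), toFock w⟫_ℂ

lemma IsFormalAdjoint.of_single {C D : Module.End ℂ FiniteFock}
    (h : ∀ j w, C w j = ⟪toFock (D (Finsupp.single j 1)), toFock w⟫_ℂ) : IsFormalAdjoint C D := by
  intro v w
  induction v using Finsupp.induction_linear with
  | zero => simp
  | add v v' hv hv' => simp only [map_add, inner_add_left, hv, hv']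
  | single j c =>
    have e : Finsupp.single j c = c • (Finsupp.single j 1 : FiniteFock) := by simp
    rw [e, map_smul, map_smul, map_smul, inner_smul_left, inner_smul_left,
      inner_toFock_single_left, toFock_apply, ← h]
    simp

lemma isFormalAdjoint_A : IsFormalAdjoint creA annA := by
  refine .of_single fun j w => ?_
  rw [WeightedShift.represents_creA, annA, Finsupp.linearCombination_single, one_smul,
    inner_toFock_single_left, toFock_apply, Complex.conj_ofReal]
  rfl

lemma isFormalAdjoint_B : IsFormalAdjoint creB annB := by
  refine .of_single fun j w => ?_
  rw [WeightedShift.represents_creB, annB, Finsupp.linearCombination_single, one_smul,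
    inner_toFock_single_left, toFock_apply, Complex.conj_ofReal]
  rfl

lemma annB_mul_annA : annB * annA = annA * annB := by
  refine LinearMap.ext fun v => Finsupp.ext fun k => ?_
  rw [WeightedShift.represents_annAB, Module.End.mul_apply, WeightedShift.represents_annB]
  simp only [WeightedShift.apply, WeightedShift.represents_annA _ _, WeightedShift.annA,
    WeightedShift.annB, WeightedShift.annAB]
  push_cast
  ring

lemma isFormalAdjoint_AB : IsFormalAdjoint (creA * creB) (annA * annB) := by
  intro v w
  rw [← annB_mul_annA, Module.End.mul_apply, Module.End.mul_apply, isFormalAdjoint_A,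
    isFormalAdjoint_B]

lemma IsFormalAdjoint.skew {C D : Module.End ℂ FiniteFock} (h : IsFormalAdjoint C D) (z : ℂ)
    (v : FiniteFock) : (⟪toFock v, toFock ((z • C - (starRingEnd ℂ) z • D) v)⟫_ℂ).re = 0 := by
  have e : ⟪toFock v, toFock (C v)⟫_ℂ = (starRingEnd ℂ) ⟪toFock v, toFock (D v)⟫_ℂ := by
    rw [h, inner_conj_symm]
  rw [LinearMap.sub_apply, LinearMap.smul_apply, LinearMap.smul_apply, map_sub, map_smul, map_smul,
    inner_sub_right, inner_smul_right, inner_smul_right, e]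
  generalize ⟪toFock v, toFock (D v)⟫_ℂ = x
  simp only [Complex.sub_re, Complex.mul_re, Complex.conj_re, Complex.conj_im]
  ring

/-! ### Annihilation operators on exponential vectors -/

namespace WeightedShift

variable (T l u : ℂ) (hT : ‖T‖ < 1)

lemma expVec_annA :
    annA.expVec T l u hT = T • creB.expVec T l u hT + l • _root_.expVec T l u hT := by
  ext k
  simp only [lp.coeFn_add, lp.coeFn_smul, Pi.add_apply, Pi.smul_apply, smul_eq_mul, expVec_apply,
    apply, annA, creB, id, expAmp]
  rw [sqrt_mul_expCoeff_succ_left]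
  push_cast
  ring

lemma expVec_annB :
    annB.expVec T l u hT = T • creA.expVec T l u hT + u • _root_.expVec T l u hT := by
  ext k
  simp only [lp.coeFn_add, lp.coeFn_smul, Pi.add_apply, Pi.smul_apply, smul_eq_mul, expVec_apply,
    apply, annB, creA, id, expAmp]
  rw [sqrt_mul_expCoeff_succ_right]
  push_cast
  ring

lemma expVec_annAB : annAB.expVec T 0 0 hT =
    T • _root_.expVec T 0 0 hT + T ^ 2 • creAB.expVec T 0 0 hT := by
  ext k
  simp only [lp.coeFn_add, lp.coeFn_smul, Pi.add_apply, Pi.smul_apply, smul_eq_mul, expVec_apply,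
    apply, annAB, creAB, id, expAmp]
  have h1 := sqrt_mul_expCoeff_succ_left T 0 0 k.1 (k.2 + 1)
  have h2 := nat_mul_expCoeff_right T 0 0 k.1 k.2
  have h3 := ofReal_sqrt_succ_sq k.2
  simp only [Nat.add_sub_cancel, Nat.cast_succ] at h1
  push_cast
  linear_combination (Real.sqrt (k.2 + 1) : ℂ) * h1 + T * expCoeff T 0 0 k.1 k.2 * h3 + T * h2

end WeightedShift

/-! ### The three gates -/

lemma expVec_zero : expVec 0 0 0 (by simp) = fockState (0, 0) := by
  ext ⟨m, n⟩
  rw [expVec_apply, fockState, lp.single_apply]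
  rcases m with _ | m
  · rcases n with _ | n
    · simp [expCoeff]
    · rw [Pi.single_eq_of_ne (by simp)]; simp [expCoeff]
  · rw [Pi.single_eq_of_ne (by simp)]; simp [expCoeff]

lemma norm_ofReal_tanh_lt_one (x : ℝ) : ‖((Real.tanh x : ℝ) : ℂ)‖ < 1 := by
  rw [Complex.norm_real, Real.norm_eq_abs]; exact Real.abs_tanh_lt_one x

lemma hasDerivAt_ofReal_tanh (g t : ℝ) :
    HasDerivAt (fun t : ℝ => ((Real.tanh (g * t) : ℝ) : ℂ))
      (g * (1 - ((Real.tanh (g * t) : ℝ) : ℂ) ^ 2)) t := by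
  have h0 : HasDerivAt (fun t : ℝ => g * t) g t := by simpa using (hasDerivAt_id t).const_mul g
  have hc : Real.cosh (g * t) ≠ 0 := (Real.cosh_pos _).ne'
  have h := (h0.sinh.div h0.cosh hc).ofReal_comp
  simp only [Real.tanh_eq_sinh_div_cosh]
  refine HasDerivAt.congr_deriv h ?_
  rw [← Complex.ofReal_one, ← Complex.ofReal_pow, ← Complex.ofReal_sub, ← Complex.ofReal_mul]
  congr 1
  field_simp

lemma hasDerivAt_ofReal_inv_cosh (g t : ℝ) :
    HasDerivAt (fun t : ℝ => (((Real.cosh (g * t))⁻¹ : ℝ) : ℂ))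
      (-(g * ((Real.tanh (g * t) : ℝ) : ℂ) * (((Real.cosh (g * t))⁻¹ : ℝ) : ℂ))) t := by
  have h0 : HasDerivAt (fun t : ℝ => g * t) g t := by simpa using (hasDerivAt_id t).const_mul g
  have hc : Real.cosh (g * t) ≠ 0 := (Real.cosh_pos _).ne'
  have h := (h0.cosh.inv hc).ofReal_comp
  simp only [Real.tanh_eq_sinh_div_cosh]
  refine HasDerivAt.congr_deriv h ?_
  rw [← Complex.ofReal_mul, ← Complex.ofReal_mul, ← Complex.ofReal_neg]
  congr 1
  field_simp

lemma continuous_ofReal_tanh (g : ℝ) : Continuous fun t : ℝ => ((Real.tanh (g * t) : ℝ) : ℂ) :=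
  continuous_iff_continuousAt.mpr fun t => (hasDerivAt_ofReal_tanh g t).continuousAt

/-- The squeezed vacuum. Along the orbit `T = tanh (g t)` and the scalar factor is
`1 / cosh (g t)`. -/
lemma twoModeSqueezer_fockState (g : ℝ) :
    twoModeSqueezer g (fockState (0, 0)) =
        (((Real.cosh g)⁻¹ : ℝ) : ℂ) • expVec (Real.tanh g : ℝ) 0 0 (norm_ofReal_tanh_lt_one g) ∧
      ‖twoModeSqueezer g (fockState (0, 0))‖ = 1 := by
  -- `g` is real, so the generator has the skew form `z C - z* D` with `D` adjoint to `C`.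
  have hgen : (g : ℂ) • (creA * creB - annA * annB) =
      (g : ℂ) • (creA * creB) - (starRingEnd ℂ) (g : ℂ) • (annA * annB) := by
    rw [Complex.conj_ofReal]
    exact LinearMap.ext fun v => by simp [smul_sub]
  have hc' : Continuous fun t : ℝ =>
      -(g * ((Real.tanh (g * t) : ℝ) : ℂ) * (((Real.cosh (g * t))⁻¹ : ℝ) : ℂ)) :=
    ((continuous_const.mul (continuous_ofReal_tanh g)).mul (continuous_iff_continuousAt.mpr
      fun t => (hasDerivAt_ofReal_inv_cosh g t).continuousAt)).neg
  have key := expOp_eq_of_expVec_curve (isFormalAdjoint_AB.skew (g : ℂ))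
    (l := fun _ => 0) (u := fun _ => 0) (l' := fun _ => 0) (u' := fun _ => 0)
    (fun t => norm_ofReal_tanh_lt_one (g * t)) (hasDerivAt_ofReal_inv_cosh g)
    (hasDerivAt_ofReal_tanh g) (fun t => hasDerivAt_const t 0) (fun t => hasDerivAt_const t 0)
    hc' (continuous_const.mul (continuous_const.sub ((continuous_ofReal_tanh g).pow 2)))
    continuous_const continuous_const (fun t => by
      have h := (closedGraph _).smul_mem (((Real.cosh (g * t))⁻¹ : ℝ) : ℂ)
        (expVec_mem_closedGraph WeightedShift.represents_creAB WeightedShift.represents_annAB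
          (g : ℂ) ((starRingEnd ℂ) (g : ℂ)) _ 0 0 (norm_ofReal_tanh_lt_one (g * t)))
      rw [WeightedShift.expVec_annAB, Complex.conj_ofReal] at h
      rw [Complex.conj_ofReal]
      convert h using 1
      refine Prod.ext rfl ?_
      simp only [Prod.smul_snd]
      module)
  have e0 : (((Real.cosh (g * 0))⁻¹ : ℝ) : ℂ) •
      expVec ((Real.tanh (g * 0) : ℝ) : ℂ) 0 0 (norm_ofReal_tanh_lt_one (g * 0)) =
      fockState (0, 0) := by
    simp [← expVec_zero]
  have e1 : (((Real.cosh (g * 1))⁻¹ : ℝ) : ℂ) •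
      expVec ((Real.tanh (g * 1) : ℝ) : ℂ) 0 0 (norm_ofReal_tanh_lt_one (g * 1)) =
      (((Real.cosh g)⁻¹ : ℝ) : ℂ) •
        expVec (Real.tanh g : ℝ) 0 0 (norm_ofReal_tanh_lt_one g) := by
    simp only [mul_one]
  rw [e0, e1, ← hgen] at key
  refine ⟨key.1, ?_⟩
  have hn : ‖fockState (0, 0)‖ = 1 := by
    rw [fockState, lp.norm_single (by norm_num)]; simp
  exact (congrArg norm key.1).trans (key.2.trans hn)

lemma hasDerivAt_affine (p q : ℂ) (t : ℝ) : HasDerivAt (fun t : ℝ => p + q * (t : ℂ)) q t := by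
  have h := ((Complex.ofRealCLM.hasDerivAt (x := t)).const_mul q).const_add p
  simpa using h

/-- The scalar factor along the orbit of a displacement, which solves `c' = -α* (p + α t) c`: the
annihilation part of the generator contributes `-α*` times the current parameter `p + α t`. -/
lemma hasDerivAt_displacement_factor (c α p : ℂ) (t : ℝ) :
    HasDerivAt (fun t : ℝ => c * Complex.exp (-((starRingEnd ℂ) α * (p * t + α / 2 * t ^ 2))))
      (-((starRingEnd ℂ) α * (p + α * t)) *
        (c * Complex.exp (-((starRingEnd ℂ) α * (p * t + α / 2 * t ^ 2))))) t := by
  have h0 : HasDerivAt (fun t : ℝ => (t : ℂ)) 1 t := by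
    simpa using (hasDerivAt_id t).ofReal_comp
  have h := ((((h0.const_mul p).add ((h0.pow 2).const_mul (α / 2))).const_mul
    ((starRingEnd ℂ) α)).neg.cexp).const_mul c
  refine HasDerivAt.congr_deriv h ?_
  simp only [Pi.add_apply, Pi.neg_apply, Pi.pow_apply]
  push_cast
  ring

lemma continuous_displacement_factor (c α p : ℂ) :
    Continuous fun t : ℝ => -((starRingEnd ℂ) α * (p + α * t)) *
        (c * Complex.exp (-((starRingEnd ℂ) α * (p * t + α / 2 * t ^ 2)))) := by
  have h : Continuous fun t : ℝ => (t : ℂ) := Complex.continuous_ofReal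
  fun_prop

/-- A displacement of the first mode maps exponential vectors to exponential vectors and preserves
their norm. -/
lemma displaceA_smul_expVec (α c T l u : ℂ) (hT : ‖T‖ < 1) :
    displaceA α (c • expVec T l u hT) =
        (c * Complex.exp (-((starRingEnd ℂ) α * (l + α / 2)))) •
          expVec T (l + α) (u - (starRingEnd ℂ) α * T) hT ∧
      ‖displaceA α (c • expVec T l u hT)‖ = ‖c • expVec T l u hT‖ := by
  have key := expOp_eq_of_expVec_curve (isFormalAdjoint_A.skew α) (T := fun _ => T)
    (T' := fun _ => 0) (l' := fun _ => α) (u' := fun _ => -(starRingEnd ℂ) α * T)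
    (fun _ => hT) (hasDerivAt_displacement_factor c α l) (fun t => hasDerivAt_const t T)
    (hasDerivAt_affine l α) (hasDerivAt_affine u (-(starRingEnd ℂ) α * T))
    (continuous_displacement_factor c α l) continuous_const continuous_const continuous_const
    (fun t => by
      have h := (closedGraph _).smul_mem
        (c * Complex.exp (-((starRingEnd ℂ) α * (l * t + α / 2 * t ^ 2))))
        (expVec_mem_closedGraph WeightedShift.represents_creA WeightedShift.represents_annA
          α ((starRingEnd ℂ) α) T (l + α * t) (u + -(starRingEnd ℂ) α * T * t) hT)
      rw [WeightedShift.expVec_annA] at h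
      convert h using 1
      refine Prod.ext rfl ?_
      simp only [Prod.smul_snd]
      module)
  have e1 : u + -(starRingEnd ℂ) α * T = u - (starRingEnd ℂ) α * T := by ring
  simp only [Complex.ofReal_zero, Complex.ofReal_one, mul_zero, add_zero, mul_one, one_pow, e1,
    ne_eq, OfNat.ofNat_ne_zero, not_false_eq_true, zero_pow, neg_zero, Complex.exp_zero] at key
  exact ⟨key.1, (congrArg norm key.1).trans key.2⟩

/-- A displacement of the second mode maps exponential vectors to exponential vectors and preserves
their norm. -/
lemma displaceB_smul_expVec (β c T l u : ℂ) (hT : ‖T‖ < 1) :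
    displaceB β (c • expVec T l u hT) =
        (c * Complex.exp (-((starRingEnd ℂ) β * (u + β / 2)))) •
          expVec T (l - (starRingEnd ℂ) β * T) (u + β) hT ∧
      ‖displaceB β (c • expVec T l u hT)‖ = ‖c • expVec T l u hT‖ := by
  have key := expOp_eq_of_expVec_curve (isFormalAdjoint_B.skew β) (T := fun _ => T)
    (T' := fun _ => 0) (l' := fun _ => -(starRingEnd ℂ) β * T) (u' := fun _ => β)
    (fun _ => hT) (hasDerivAt_displacement_factor c β u) (fun t => hasDerivAt_const t T)
    (hasDerivAt_affine l (-(starRingEnd ℂ) β * T)) (hasDerivAt_affine u β)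
    (continuous_displacement_factor c β u) continuous_const continuous_const continuous_const
    (fun t => by
      have h := (closedGraph _).smul_mem
        (c * Complex.exp (-((starRingEnd ℂ) β * (u * t + β / 2 * t ^ 2))))
        (expVec_mem_closedGraph WeightedShift.represents_creB WeightedShift.represents_annB
          β ((starRingEnd ℂ) β) T (l + -(starRingEnd ℂ) β * T * t) (u + β * t) hT)
      rw [WeightedShift.expVec_annB] at h
      convert h using 1
      refine Prod.ext rfl ?_
      simp only [Prod.smul_snd]
      module)
  have e1 : l + -(starRingEnd ℂ) β * T = l - (starRingEnd ℂ) β * T := by ring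
  simp only [Complex.ofReal_zero, Complex.ofReal_one, mul_zero, add_zero, mul_one, one_pow, e1,
    ne_eq, OfNat.ofNat_ne_zero, not_false_eq_true, zero_pow, neg_zero, Complex.exp_zero] at key
  exact ⟨key.1, (congrArg norm key.1).trans key.2⟩

/-! ### The norm of an exponential vector -/

/-- The state of the circuit is a multiple of an exponential vector. -/
lemma circuitState_eq {g T : ℝ} (hT : T = Real.tanh g) (hT1 : ‖(T : ℂ)‖ < 1) (α β : ℂ) :
    circuitState g α β =
        ((((Real.cosh g)⁻¹ : ℝ) : ℂ) * Complex.exp (-((starRingEnd ℂ) β * (0 + β / 2))) *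
          Complex.exp (-((starRingEnd ℂ) α *
            (0 - (starRingEnd ℂ) β * T + α / 2)))) •
          expVec T (α - (starRingEnd ℂ) β * T)
            (β - (starRingEnd ℂ) α * T) hT1 ∧
      ‖circuitState g α β‖ = 1 := by
  subst hT
  obtain ⟨s1, s2⟩ := twoModeSqueezer_fockState g
  obtain ⟨b1, b2⟩ := displaceB_smul_expVec β (((Real.cosh g)⁻¹ : ℝ) : ℂ) (Real.tanh g : ℝ) 0 0
    hT1
  rw [← s1] at b1 b2
  obtain ⟨a1, a2⟩ := displaceA_smul_expVec α
    ((((Real.cosh g)⁻¹ : ℝ) : ℂ) * Complex.exp (-((starRingEnd ℂ) β * (0 + β / 2))))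
    (Real.tanh g : ℝ) (0 - (starRingEnd ℂ) β * (Real.tanh g : ℝ)) (0 + β)
    hT1
  rw [← b1] at a1 a2
  refine ⟨a1.trans ?_, a2.trans (b2.trans s2)⟩
  congr 2 <;> ring

lemma norm_sq_circuit_factor {g T : ℝ} (hT : T = Real.tanh g) (α β : ℂ) :
    ‖((((Real.cosh g)⁻¹ : ℝ) : ℂ) * Complex.exp (-((starRingEnd ℂ) β * (0 + β / 2))) *
        Complex.exp (-((starRingEnd ℂ) α *
          (0 - (starRingEnd ℂ) β * T + α / 2))))‖ ^ 2 =
      (1 - T ^ 2) *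
        Real.exp (-(‖α‖ ^ 2 + ‖β‖ ^ 2) + 2 * T * (α * β).re) := by
  have h1 : ((Real.cosh g)⁻¹) ^ 2 = 1 - T ^ 2 := by
    have hc : Real.cosh g ≠ 0 := (Real.cosh_pos g).ne'
    have := Real.cosh_sq g
    rw [hT, Real.tanh_eq_sinh_div_cosh]
    field_simp
    linarith
  rw [norm_mul, norm_mul, mul_pow, mul_pow, Complex.norm_real, Real.norm_eq_abs, sq_abs, h1,
    Complex.norm_exp, Complex.norm_exp, mul_assoc, ← Real.exp_nat_mul, ← Real.exp_nat_mul,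
    ← Real.exp_add]
  congr 2
  rw [Complex.sq_norm, Complex.normSq_apply, Complex.sq_norm, Complex.normSq_apply]
  simp
  ring

/-- The norm of an exponential vector. The circuit with `α = (l + T u*) / (1 - T²)` and
`β = (u + T l*) / (1 - T²)` produces a multiple of it, of norm one and with a known factor. -/
theorem norm_sq_expVec (T : ℝ) (l u : ℂ) (hT : ‖(T : ℂ)‖ < 1) :
    ‖expVec T l u hT‖ ^ 2 =
      (1 - T ^ 2)⁻¹ * Real.exp ((‖l‖ ^ 2 + ‖u‖ ^ 2 + 2 * T * (l * u).re) / (1 - T ^ 2)) := by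
  have hT' : |T| < 1 := by rwa [Complex.norm_real, Real.norm_eq_abs] at hT
  obtain ⟨g, hg⟩ : ∃ g, T = Real.tanh g :=
    ⟨Real.artanh T, (Real.tanh_artanh (abs_lt.mp hT')).symm⟩
  have hD : 0 < 1 - T ^ 2 := by
    have := (sq_lt_one_iff_abs_lt_one _).mpr hT'
    linarith
  obtain ⟨e, hn⟩ := circuitState_eq hg hT
    ((l + T * (starRingEnd ℂ) u) / ((1 - T ^ 2 : ℝ) : ℂ))
    ((u + T * (starRingEnd ℂ) l) / ((1 - T ^ 2 : ℝ) : ℂ))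
  have hf := norm_sq_circuit_factor hg
    ((l + T * (starRingEnd ℂ) u) / ((1 - T ^ 2 : ℝ) : ℂ))
    ((u + T * (starRingEnd ℂ) l) / ((1 - T ^ 2 : ℝ) : ℂ))
  rw [e, norm_smul] at hn
  have hn2 := congrArg (· ^ 2) hn
  simp only [mul_pow, one_pow] at hn2
  rw [hf] at hn2
  have hDc : ((1 - T ^ 2 : ℝ) : ℂ) ≠ 0 := by exact_mod_cast hD.ne'
  have el : (l + T * (starRingEnd ℂ) u) / ((1 - T ^ 2 : ℝ) : ℂ) -
      (starRingEnd ℂ) ((u + T * (starRingEnd ℂ) l) / ((1 - T ^ 2 : ℝ) : ℂ)) * T = l := by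
    simp only [map_div₀, map_add, map_mul, Complex.conj_ofReal, Complex.conj_conj]
    field_simp
    push_cast
    ring
  have eu : (u + T * (starRingEnd ℂ) l) / ((1 - T ^ 2 : ℝ) : ℂ) -
      (starRingEnd ℂ) ((l + T * (starRingEnd ℂ) u) / ((1 - T ^ 2 : ℝ) : ℂ)) * T = u := by
    simp only [map_div₀, map_add, map_mul, Complex.conj_ofReal, Complex.conj_conj]
    field_simp
    push_cast
    ring
  simp only [el, eu] at hn2
  have ee : -(‖(l + T * (starRingEnd ℂ) u) / ((1 - T ^ 2 : ℝ) : ℂ)‖ ^ 2 +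
      ‖(u + T * (starRingEnd ℂ) l) / ((1 - T ^ 2 : ℝ) : ℂ)‖ ^ 2) + 2 * T *
      ((l + T * (starRingEnd ℂ) u) / ((1 - T ^ 2 : ℝ) : ℂ) *
        ((u + T * (starRingEnd ℂ) l) / ((1 - T ^ 2 : ℝ) : ℂ))).re =
      -((‖l‖ ^ 2 + ‖u‖ ^ 2 + 2 * T * (l * u).re) / (1 - T ^ 2)) := by
    rw [div_mul_div_comm, ← Complex.ofReal_mul, Complex.div_ofReal_re, norm_div, norm_div, div_pow,
      div_pow, Complex.norm_real, Real.norm_eq_abs, sq_abs]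
    simp only [Complex.sq_norm, Complex.normSq_apply, Complex.mul_re, Complex.add_re,
      Complex.add_im, Complex.mul_im, Complex.conj_re, Complex.conj_im, Complex.ofReal_re,
      Complex.ofReal_im]
    field_simp
    ring
  rw [ee, Real.exp_neg] at hn2
  field_simp at hn2 ⊢
  linarith

/-! ### No-click probabilities -/

lemma inner_diagonalOp (w : ℕ × ℕ → unitInterval) (φ : TwoModeFock) :
    ⟪φ, diagonalOp w φ⟫_ℂ = ((∑' k, (w k : ℝ) * ‖φ k‖ ^ 2 : ℝ) : ℂ) := by
  rw [lp.inner_eq_tsum, Complex.ofReal_tsum]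
  refine tsum_congr fun k => ?_
  have h : (diagonalOp w φ) k = ((w k : ℝ) : ℂ) * φ k := rfl
  rw [h, RCLike.inner_apply, mul_assoc, Complex.mul_conj, Complex.normSq_eq_norm_sq]
  push_cast
  rfl

/-- Damping an exponential vector by `√x` and `√y` gives another exponential vector. -/
lemma tsum_mul_norm_sq_expVec {x y : ℝ} (hx : 0 ≤ x) (hx1 : x ≤ 1) (hy : 0 ≤ y) (hy1 : y ≤ 1)
    (T : ℝ) (l u c : ℂ) (hT : ‖(T : ℂ)‖ < 1) :
    ∑' k : ℕ × ℕ, (x ^ k.1 * y ^ k.2) * ‖(c • expVec T l u hT) k‖ ^ 2 =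
      ‖c‖ ^ 2 * ((1 - x * y * T ^ 2)⁻¹ * Real.exp ((x * ‖l‖ ^ 2 + y * ‖u‖ ^ 2 +
        2 * (x * y * T) * (l * u).re) / (1 - x * y * T ^ 2))) := by
  have hxs := Real.sq_sqrt hx
  have hys := Real.sq_sqrt hy
  have hT' : ‖((Real.sqrt x * Real.sqrt y * T : ℝ) : ℂ)‖ < 1 := by
    rw [Complex.norm_real, norm_mul, norm_mul, Real.norm_of_nonneg (Real.sqrt_nonneg _),
      Real.norm_of_nonneg (Real.sqrt_nonneg _), ← Complex.norm_real T]
    have h1 : Real.sqrt x * Real.sqrt y ≤ 1 :=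
      mul_le_one₀ (Real.sqrt_le_one.mpr hx1) (Real.sqrt_nonneg _) (Real.sqrt_le_one.mpr hy1)
    exact (mul_le_of_le_one_left (norm_nonneg _) h1).trans_lt hT
  have h := norm_sq_expVec (Real.sqrt x * Real.sqrt y * T) (Real.sqrt x * l) (Real.sqrt y * u) hT'
  have e1 : (Real.sqrt x * Real.sqrt y * T) ^ 2 = x * y * T ^ 2 := by
    rw [mul_pow, mul_pow, hxs, hys]
  have e2 : 2 * (Real.sqrt x * Real.sqrt y * T) * ((Real.sqrt x : ℂ) * l * (Real.sqrt y * u)).re =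
      2 * (x * y * T) * (l * u).re := by
    rw [mul_mul_mul_comm, ← Complex.ofReal_mul, Complex.re_ofReal_mul]
    linear_combination (2 * T * (l * u).re * (Real.sqrt y) ^ 2) * hxs +
      (2 * T * (l * u).re * x) * hys
  have e3 : ∀ z : ℂ, ∀ r : ℝ, 0 ≤ r → ‖(Real.sqrt r : ℂ) * z‖ ^ 2 = r * ‖z‖ ^ 2 := by
    intro z r hr
    rw [norm_mul, mul_pow, norm_ofReal_sqrt, Real.sq_sqrt hr]
  rw [e1, e2, e3 l x hx, e3 u y hy, norm_sq_eq_tsum] at h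
  rw [← h, ← tsum_mul_left]
  refine tsum_congr fun k => ?_
  rw [lp.coeFn_smul, Pi.smul_apply, expVec_apply, expVec_apply, smul_eq_mul, norm_mul, mul_pow]
  push_cast
  rw [← expCoeff_scale, norm_mul, norm_mul, norm_pow, norm_pow, norm_ofReal_sqrt, norm_ofReal_sqrt,
    mul_pow, mul_pow, ← pow_mul, ← pow_mul, mul_comm k.1, mul_comm k.2, pow_mul, pow_mul, hxs, hys]
  ring

/-- The expectation in the state of the circuit of the operator with eigenvalues `xᵐ yⁿ`. The
exponent `E` is given by the value of `E (1 - x y T²)`; the brackets after `x`, `y` and `x y T` are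
`|l|²`, `|u|²` and `Re (l u)` for `l = α - β* T` and `u = β - α* T`. -/
theorem inner_circuitState_diagonalOp (g : ℝ) (α β : ℂ) {x y : ℝ} (hx : 0 ≤ x) (hx1 : x ≤ 1)
    (hy : 0 ≤ y) (hy1 : y ≤ 1) {w : ℕ × ℕ → unitInterval}
    (hw : ∀ k, (w k : ℝ) = x ^ k.1 * y ^ k.2) {T E : ℝ} (hT : T = Real.tanh g)
    (hE : E * (1 - x * y * T ^ 2) =
      (-(‖α‖ ^ 2 + ‖β‖ ^ 2) + 2 * T * (α * β).re) * (1 - x * y * T ^ 2) +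
      x * (‖α‖ ^ 2 + T ^ 2 * ‖β‖ ^ 2 - 2 * T * (α * β).re) +
      y * (‖β‖ ^ 2 + T ^ 2 * ‖α‖ ^ 2 - 2 * T * (α * β).re) +
      2 * (x * y * T) * ((1 + T ^ 2) * (α * β).re - T * (‖α‖ ^ 2 + ‖β‖ ^ 2))) :
    ⟪circuitState g α β, diagonalOp w (circuitState g α β)⟫_ℂ =
      (((1 - T ^ 2) / (1 - x * y * T ^ 2) * Real.exp E : ℝ) : ℂ) := by
  have hT1 : ‖(T : ℂ)‖ < 1 := hT ▸ norm_ofReal_tanh_lt_one g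
  have hD : 0 < 1 - x * y * T ^ 2 := by
    have h1 : T ^ 2 < 1 := by
      rw [hT]; exact (sq_lt_one_iff_abs_lt_one _).mpr (Real.abs_tanh_lt_one g)
    have h2 : x * y ≤ 1 := mul_le_one₀ hx1 hy hy1
    nlinarith [mul_nonneg hx hy, sq_nonneg T]
  rw [inner_diagonalOp]
  congr 1
  simp only [hw]
  rw [(circuitState_eq hT hT1 α β).1, tsum_mul_norm_sq_expVec hx hx1 hy hy1,
    norm_sq_circuit_factor hT]
  have el : ‖α - (starRingEnd ℂ) β * T‖ ^ 2 = ‖α‖ ^ 2 + T ^ 2 * ‖β‖ ^ 2 - 2 * T * (α * β).re := by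
    simp only [Complex.sq_norm, Complex.normSq_apply]
    simp
    ring
  have eu : ‖β - (starRingEnd ℂ) α * T‖ ^ 2 = ‖β‖ ^ 2 + T ^ 2 * ‖α‖ ^ 2 - 2 * T * (α * β).re := by
    simp only [Complex.sq_norm, Complex.normSq_apply]
    simp
    ring
  have ep : ((α - (starRingEnd ℂ) β * T) * (β - (starRingEnd ℂ) α * T)).re =
      (1 + T ^ 2) * (α * β).re - T * (‖α‖ ^ 2 + ‖β‖ ^ 2) := by
    simp only [Complex.sq_norm, Complex.normSq_apply]
    simp
    ring
  rw [el, eu, ep, mul_mul_mul_comm, ← Real.exp_add, ← div_eq_mul_inv]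
  congr 2
  have hD0 := hD.ne'
  rw [← mul_right_cancel_iff_of_pos hD, hE, add_mul, div_mul_cancel₀ _ hD0]
  ring

theorem mainTheorem3 (g : ℝ) (α β : ℂ) (η : unitInterval) (R T : ℝ)
    (hR : R = 1 - (η : ℝ)) (hT : T = Real.tanh g) :
    ⟪circuitState g α β, noClickAB η (circuitState g α β)⟫_ℂ =
      (((1 - T ^ 2) / (1 - R ^ 2 * T ^ 2) *
        Real.exp ((‖α‖ ^ 2 + ‖β‖ ^ 2) *
            ((1 - R + R ^ 2 * T ^ 2 - R * T ^ 2) / (R ^ 2 * T ^ 2 - 1)) -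
          2 * (α * β).re * T * (R - 1) ^ 2 / (R ^ 2 * T ^ 2 - 1)) : ℝ) : ℂ) ∧
    ⟪circuitState g α β, noClickA η (circuitState g α β)⟫_ℂ =
      (((1 - T ^ 2) / (1 - R * T ^ 2) *
        Real.exp (‖α‖ ^ 2 * ((1 - R + R * T ^ 2 - T ^ 2) / (R * T ^ 2 - 1))) : ℝ) : ℂ) ∧
    ⟪circuitState g α β, noClickB η (circuitState g α β)⟫_ℂ =
      (((1 - T ^ 2) / (1 - R * T ^ 2) *
        Real.exp (‖β‖ ^ 2 * ((1 - R + R * T ^ 2 - T ^ 2) / (R * T ^ 2 - 1))) : ℝ) : ℂ) := by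
  have hR0 : 0 ≤ R := by have := η.2.2; linarith
  have hR1 : R ≤ 1 := by have := η.2.1; linarith
  have hT1 : T ^ 2 < 1 := by
    rw [hT]; exact (sq_lt_one_iff_abs_lt_one _).mpr (Real.abs_tanh_lt_one g)
  have hη : ((unitInterval.symm η : unitInterval) : ℝ) = R := by
    rw [unitInterval.coe_symm_eq, hR]
  have hd1 : R * T ^ 2 - 1 ≠ 0 := by nlinarith [sq_nonneg T]
  have hd2 : R ^ 2 * T ^ 2 - 1 ≠ 0 := by nlinarith [sq_nonneg T, mul_nonneg hR0 (sq_nonneg T)]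
  refine ⟨?_, ?_, ?_⟩
  · have h := inner_circuitState_diagonalOp g α β hR0 hR1 hR0 hR1
      (w := fun k => unitInterval.symm η ^ (k.1 + k.2))
      (fun k => by rw [Set.Icc.coe_pow, hη, pow_add]) hT
      (E := (‖α‖ ^ 2 + ‖β‖ ^ 2) * ((1 - R + R ^ 2 * T ^ 2 - R * T ^ 2) / (R ^ 2 * T ^ 2 - 1)) -
          2 * (α * β).re * T * (R - 1) ^ 2 / (R ^ 2 * T ^ 2 - 1)) (by
        field_simp
        ring)
    rw [← sq] at h
    exact h
  · have h := inner_circuitState_diagonalOp g α β hR0 hR1 zero_le_one le_rfl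
      (w := fun k => unitInterval.symm η ^ k.1)
      (fun k => by simp only [Set.Icc.coe_pow, hη, one_pow, mul_one]) hT
      (E := ‖α‖ ^ 2 * ((1 - R + R * T ^ 2 - T ^ 2) / (R * T ^ 2 - 1))) (by
        field_simp
        ring)
    rw [mul_one] at h
    exact h
  · have h := inner_circuitState_diagonalOp g α β zero_le_one le_rfl hR0 hR1
      (w := fun k => unitInterval.symm η ^ k.2)
      (fun k => by simp only [Set.Icc.coe_pow, hη, one_pow, one_mul]) hT
      (E := ‖β‖ ^ 2 * ((1 - R + R * T ^ 2 - T ^ 2) / (R * T ^ 2 - 1))) (by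
        field_simp
        ring)
    rw [one_mul] at h
    exact h
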